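/- **Setting.** Let $\boldsymbol V$ be a finite set of variables (nodes), variable $i$ taking values in a measurable space with a $\sigma$-finite reference measure $\mu_i$; densities are with respect to the product of these measures, integrals $\int\cdot\,d\boldsymbol s$ are over the coordinates in $\boldsymbol S$ with respect to $\mu_{\boldsymbol S}=\prod_{i\in \boldsymbol S}\mu_i$, $p_{\boldsymbol S}$ is the marginal density of $\boldsymbol S$, and $p_{\boldsymbol B}(\boldsymbol b\mid \boldsymbol s)=p_{\boldsymbol B\cup \boldsymbol S}(\boldsymbol b,\boldsymbol s)/p_{\boldsymbol S}(\boldsymbol s)$, with the convention $0/0=0$. A density $p$ is Markovian to a DAG $\mathcal D$ if $p(\boldsymbol v)=\prod_i p_{V_i}(v_i\mid \mathrm{pa}_{\mathcal D}(v_i))$ for almost every $\boldsymbol v$. An MPDAG $\mathcal G$ is the graph with directed and undirected edges that represents the (non-empty) set $[\mathcal G]$ of those DAGs in a Markov equivalence class (the DAGs with the same d-separations as a given DAG) that contain a given set of directed edges (background knowledge): an edge is directed in $\mathcal G$ if it has that direction in every DAG in $[\mathcal G]$, and undirected if both directions occur. It is an SA-MPDAG if it has no semi-directed cycle, i.e.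 no cycle of edges $\to$ or $-$ that contains at least one $\to$. A density is compatible to $\mathcal G$ if it is Markovian to every DAG in $[\mathcal G]$. $\mathrm{Pa}_{\mathcal G}(\boldsymbol D)$ is the set of nodes with a directed edge into $\boldsymbol D$; $\mathrm{An}_{\mathcal G}(\boldsymbol D)$ is the set of nodes with a directed path (possibly of length $0$) to $\boldsymbol D$; $\mathcal G_{\boldsymbol D}$ is the induced subgraph on $\boldsymbol D$; and $CD_{\mathcal G}(\boldsymbol D)$ is the set of non-empty intersections of $\boldsymbol D$ with the chain components of $\mathcal G$ (the connected components of its undirected part). **Proposition.** Let $\mathcal G$ be an SA-MPDAG over $\boldsymbol V$ and let $\boldsymbol X,\boldsymbol Y\subseteq \boldsymbol V$ be disjoint, such that there is no proper semi-directed path (edges $\to$ or $-$, only the first node in $\boldsymbol X$) from $\boldsymbol X$ to $\boldsymbol Y$ in $\mathcal G$ that starts with an undirected edge. Let $p$ be a density compatible to $\mathcal G$. Put $\boldsymbol A=\boldsymbol X\cap \mathrm{An}_{\mathcal G}(\boldsymbol Y)$ and $$\{\boldsymbol B_1,\dots,\boldsymbol B_k\}=CD_{\mathcal G}(\mathrm{An}_{\mathcal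 G_{\boldsymbol V\setminus \boldsymbol X}}(\boldsymbol Y)),\quad \boldsymbol B=\mathrm{An}_{\mathcal G_{\boldsymbol V\setminus \boldsymbol X}}(\boldsymbol Y)\setminus \boldsymbol Y,\quad \{\boldsymbol X_1,\dots,\boldsymbol X_m\}=CD_{\mathcal G}(\boldsymbol A),\quad \boldsymbol V'=\boldsymbol V\setminus(\boldsymbol A\cup \boldsymbol Y).$$ Then for almost every value $(\boldsymbol x,\boldsymbol y)$ of $(\boldsymbol X,\boldsymbol Y)$ such that the re-weighting factors are positive at $\boldsymbol x$ (that is, $p_{\boldsymbol X_j}(\boldsymbol x_j\mid \mathrm{pa}_{\mathcal G}(\boldsymbol X_j))\neq 0$ for every $j$ and almost all values of the variables outside $\boldsymbol A$ for which $p_{\mathrm{Pa}_{\mathcal G}(\boldsymbol X_j)}(\mathrm{pa}_{\mathcal G}(\boldsymbol X_j))\neq 0$), $$\int \prod_{j=1}^{k}p_{\boldsymbol B_j}(\boldsymbol b_j\mid \mathrm{pa}_{\mathcal G}(\boldsymbol B_j))\,d\boldsymbol b=\int \frac{p(\boldsymbol v)}{\prod_{j=1}^{m}p_{\boldsymbol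 X_j}(\boldsymbol x_j\mid \mathrm{pa}_{\mathcal G}(\boldsymbol X_j))}\,d\boldsymbol v',$$ where the values $\mathrm{pa}_{\mathcal G}(\boldsymbol B_j)$ and $\mathrm{pa}_{\mathcal G}(\boldsymbol X_j)$ agree with $\boldsymbol x$ on $\boldsymbol A$. Both sides are elements of $[0,\infty]$. (If $\boldsymbol X\subseteq \mathrm{An}_{\mathcal G}(\boldsymbol Y)$, then $\boldsymbol V'=\boldsymbol V\setminus(\boldsymbol X\cup \boldsymbol Y)$.) -/

import Mathlib

open MeasureTheory

noncomputable section

/-- A graph over the node set `V` in which any two distinct nodes are joined by no edge, by one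
directed edge `dir i j` (read `i → j`), or by one undirected edge `undir i j` (read `i - j`). -/
@[ext]
structure PDGraph (V : Type*) where
  dir : V → V → Prop
  undir : V → V → Prop
  dir_asymm : ∀ i j, dir i j → ¬ dir j i
  undir_symm : ∀ i j, undir i j → undir j i
  undir_irrefl : ∀ i, ¬ undir i i
  dir_not_undir : ∀ i j, dir i j → ¬ undir i j

namespace PDGraph

variable {V : Type*}

/-- Adjacency: some edge joins the two nodes. -/
def Adj (G : PDGraph V) (i j : V) : Prop := G.dir i j ∨ G.dir j i ∨ G.undir i j

/-- `i → j` or `i - j`: one step of a semi-directed path. -/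
def SemiStep (G : PDGraph V) (i j : V) : Prop := G.dir i j ∨ G.undir i j

/-- `i` is joined to `j` by a directed path (possibly with no edges). -/
def DirReach (G : PDGraph V) : V → V → Prop := Relation.ReflTransGen G.dir

/-- `i` is joined to `j` by an undirected path (possibly with no edges). -/
def UndirReach (G : PDGraph V) : V → V → Prop := Relation.ReflTransGen G.undir

/-- No semi-directed cycles. As usual for chain graphs, a semi-directed cycle contains at least
one directed edge `i → j`; it is closed by a semi-directed path from `j` to `i`. -/
def StrictlyAcyclic (G : PDGraph V) : Prop :=
  ∀ i j, G.dir i j → ¬ Relation.ReflTransGen G.SemiStep j i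

/-- Directed acyclic graphs. -/
def IsDAG (G : PDGraph V) : Prop :=
  (∀ i j, ¬ G.undir i j) ∧ ∀ i, ¬ Relation.TransGen G.dir i i

/-! ### d-separation and Markov equivalence of DAGs -/

/-- The node sequence `l` is a path with pairwise distinct nodes from `a` to `b`. -/
def IsPathFromTo (G : PDGraph V) (l : List V) (a b : V) : Prop :=
  l.Nodup ∧ l.IsChain G.Adj ∧ l.head? = some a ∧ l.getLast? = some b

/-- The path `l` is active (d-connecting) given `Z`: every collider on it has a descendant
(possibly itself) in `Z`, and no interior non-collider is in `Z`. -/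
def IsActive (G : PDGraph V) (Z : Set V) (l : List V) : Prop :=
  ∀ a b c, [a, b, c] <:+: l →
    ((G.dir a b ∧ G.dir c b) → ∃ z ∈ Z, G.DirReach b z) ∧
    (¬ (G.dir a b ∧ G.dir c b) → b ∉ Z)

/-- `A` and `B` are d-separated by `Z`. -/
def DSep (G : PDGraph V) (A B Z : Set V) : Prop :=
  ∀ a ∈ A, ∀ b ∈ B, ∀ l, G.IsPathFromTo l a b → ¬ G.IsActive Z l

/-- Two DAGs are Markov equivalent if they have the same d-separations. -/
def MarkovEquiv (D D' : PDGraph V) : Prop :=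
  ∀ A B Z : Set V, Disjoint A B → Disjoint A Z → Disjoint B Z →
    (D.DSep A B Z ↔ D'.DSep A B Z)

/-! ### MPDAGs -/

/-- The DAGs in the Markov equivalence class of `D₀` that contain all the directed edges `E`. -/
def restrictedClass (D₀ : PDGraph V) (E : Set (V × V)) : Set (PDGraph V) :=
  {D | D.IsDAG ∧ D.MarkovEquiv D₀ ∧ ∀ e ∈ E, D.dir e.1 e.2}

/-- `G` is the maximally oriented partially directed acyclic graph of the Markov equivalence class
of the DAG `D₀` with (consistent) background knowledge `E`: an edge is directed in `G` if it has
this direction in all the DAGs of the restricted class, and undirected if both directions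
occur. -/
def IsMPDAGOf (G D₀ : PDGraph V) (E : Set (V × V)) : Prop :=
  D₀.IsDAG ∧ (restrictedClass D₀ E).Nonempty ∧
  (∀ i j, G.dir i j ↔ ∀ D ∈ restrictedClass D₀ E, D.dir i j) ∧
  (∀ i j, G.undir i j ↔
    (∃ D ∈ restrictedClass D₀ E, D.dir i j) ∧ ∃ D ∈ restrictedClass D₀ E, D.dir j i)

/-- `G` is an MPDAG. -/
def IsMPDAG (G : PDGraph V) : Prop := ∃ D₀ E, G.IsMPDAGOf D₀ E

/-- `[G]`: the set of DAGs represented by the MPDAG `G`. -/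
def represented (G : PDGraph V) : Set (PDGraph V) :=
  {D | ∃ D₀ E, G.IsMPDAGOf D₀ E ∧ D ∈ restrictedClass D₀ E}

/-- SA-MPDAGs: MPDAGs without semi-directed cycles. -/
def IsSAMPDAG (G : PDGraph V) : Prop := G.IsMPDAG ∧ G.StrictlyAcyclic

/-- There is a proper semi-directed path `⟨x, z, …⟩` from `X` to `Y` (only its first node is
in `X`) whose first edge `x - z` is undirected. -/
def HasProperSemiDirectedPathStartingUndirected (G : PDGraph V) (X Y : Finset V) : Prop :=
  ∃ (x z : V) (l : List V), x ∈ X ∧ (∀ w ∈ z :: l, w ∉ X) ∧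
    (x :: z :: l).IsChain G.SemiStep ∧ G.undir x z ∧ ∃ y ∈ Y, (z :: l).getLast? = some y

/-- The induced subgraph on `D`, as a graph on `V` whose edges are those of `G` between nodes
of `D` (nodes outside `D` are isolated). -/
def induce (G : PDGraph V) (D : Finset V) : PDGraph V where
  dir i j := G.dir i j ∧ i ∈ D ∧ j ∈ D
  undir i j := G.undir i j ∧ i ∈ D ∧ j ∈ D
  dir_asymm i j h h' := G.dir_asymm i j h.1 h'.1
  undir_symm i j h := ⟨G.undir_symm i j h.1, h.2.2, h.2.1⟩
  undir_irrefl i h := G.undir_irrefl i h.1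
  dir_not_undir i j h h' := G.dir_not_undir i j h.1 h'.1

variable [Fintype V] [DecidableEq V]

open Classical in
/-- The parents of the node set `D`. -/
def pa (G : PDGraph V) (D : Finset V) : Finset V :=
  Finset.univ.filter fun i => ∃ j ∈ D, G.dir i j

open Classical in
/-- The ancestors of the node set `D` (including `D` itself). -/
def an (G : PDGraph V) (D : Finset V) : Finset V :=
  Finset.univ.filter fun i => ∃ j ∈ D, G.DirReach i j

open Classical in
/-- The chain component of a node. -/
def chainComponent (G : PDGraph V) (v : V) : Finset V :=
  Finset.univ.filter fun i => G.UndirReach v i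

/-- The set of chain components. -/
def chainComponents (G : PDGraph V) : Finset (Finset V) :=
  Finset.univ.image G.chainComponent

/-- The chain decomposition of `D`: the non-empty intersections of `D` with chain components. -/
def chainDecomp (G : PDGraph V) (D : Finset V) : Finset (Finset V) :=
  (G.chainComponents.image fun τ => D ∩ τ).filter fun B => B.Nonempty

end PDGraph

/-! ### Densities

Variable `i` takes values in `Ω i`, with reference measure `μ i`. Functions of a subvector are
represented as functions on the whole product that depend only on the coordinates concerned;
`lmarginal μ S f v` integrates the coordinates in `S` and fixes the others at their values
in `v`. -/

section Density

variable {V : Type*} [Fintype V] [DecidableEq V] {Ω : V → Type*} [∀ i, MeasurableSpace (Ω i)]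

/-- `p` is a joint density with respect to the product of the reference measures. -/
def IsJointDensity (μ : ∀ i, Measure (Ω i)) (p : (∀ i, Ω i) → ENNReal) : Prop :=
  Measurable p ∧ ∫⁻ v, p v ∂(Measure.pi μ) = 1

/-- The marginal density `p_S` of the variables in `S`. -/
def margDensity (μ : ∀ i, Measure (Ω i)) (p : (∀ i, Ω i) → ENNReal) (S : Finset V) :
    (∀ i, Ω i) → ENNReal :=
  lmarginal μ Sᶜ p

/-- The conditional density `p_B(b | s)` of the variables in `B` given those in `S`
(for disjoint `B`, `S`). -/
def condDensity (μ : ∀ i, Measure (Ω i)) (p : (∀ i, Ω i) → ENNReal) (B S : Finset V)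
    (v : ∀ i, Ω i) : ENNReal :=
  margDensity μ p (B ∪ S) v / margDensity μ p S v

namespace PDGraph

/-- `p` is Markovian to the DAG `D`. -/
def IsMarkovian (D : PDGraph V) (μ : ∀ i, Measure (Ω i)) (p : (∀ i, Ω i) → ENNReal) : Prop :=
  ∀ᵐ v ∂(Measure.pi μ), p v = ∏ i, condDensity μ p {i} (D.pa {i}) v

/-- `p` is compatible to the MPDAG `G`: Markovian to all the DAGs represented by `G`. -/
def IsCompatible (G : PDGraph V) (μ : ∀ i, Measure (Ω i)) (p : (∀ i, Ω i) → ENNReal) : Prop :=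
  ∀ D ∈ G.represented, D.IsMarkovian μ p

/-- Positivity at the values `x` that `v` gives to the variables in `A`: for every block `D` of
the chain decomposition of `A`, the density `p_D(x_D | pa(D))` is non-zero for almost all values
of the other variables for which the parents, at values that agree with `x`, have non-zero
density. Here `A.piecewise v w` takes its coordinates in `A` from `v`, the others from `w`. -/
def PositiveAt (G : PDGraph V) (μ : ∀ i, Measure (Ω i)) (p : (∀ i, Ω i) → ENNReal)
    (A : Finset V) (v : ∀ i, Ω i) : Prop :=
  ∀ᵐ w ∂(Measure.pi μ), ∀ D ∈ G.chainDecomp A,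
    margDensity μ p (G.pa D) (A.piecewise v w) ≠ 0 →
      condDensity μ p D (G.pa D) (A.piecewise v w) ≠ 0

end PDGraph

end Density

end

set_option linter.unusedSectionVars false

noncomputable section

namespace PDGraph

variable {V : Type*}

/-! ### Markov equivalent DAGs have the same skeleton and the same v-structures -/

/-! The core is a chain rule over chain components. Without semi-directed cycles, `i → j` and `j -
k` force `i → k` (`IsMPDAGOf.dir_of_dir_of_undir`): otherwise a semi-directed cycle closes, or two
Markov equivalent DAGs differ in a v-structure. So all nodes of a chain component have the same
parents, and a rank that increases along directed edges and is constant exactly on the components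
orders the components. A single represented DAG then suffices: its edges never decrease the rank, so
the nodes below a given rank form an ancestral set, and the Markov property yields, for each `N`
ancestral in `G`, the density of `N` as the product over ranks of the densities of the levels given
their parents (`margDensity_below_succ`).

Let `N` be the ancestors of `Y`, `A` its part in `X`, and `B` the ancestors of `Y` in the graph
without `X`. Integrating out the complement of `N` turns `p` into its marginal on `N`, since the
weights live on `N`. Then `N \ (A ∪ B)` is integrated out level by level, highest rank first
(`lmarginal_reweighted`). The path hypothesis says that no component meets both `A` and `B`
(`not_undirReach_of_not_hasPath`), so each level shrinks to a factor of `A`, which cancels against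
its weight, or to a factor of `B`, which stays. The parents of `B` lie in `A ∪ B`, so the factors
already kept are constants for the later integrations. Integrating over `B \ Y` gives the claim.

Null sets need care. With `0/0 = 0` conditional densities integrate to at most 1, so factorization
over ancestral sets is first an inequality and becomes an equality by comparing total integrals
(`margDensity_ae_eq_condProd`). Positivity at `x` enters through an indicator that depends on `A`
only and can be carried through all the integrals. -/

lemma Adj.symm {G : PDGraph V} {i j : V} (h : G.Adj i j) : G.Adj j i := by
  rcases h with h | h | h
  · exact Or.inr (Or.inl h)
  · exact Or.inl h
  · exact Or.inr (Or.inr (G.undir_symm _ _ h))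

lemma IsActive.tail {G : PDGraph V} {Z : Set V} {u : V} {l : List V} (h : G.IsActive Z (u :: l)) :
    G.IsActive Z l :=
  fun a b c habc => h a b c (habc.trans (List.suffix_cons u l).isInfix)

lemma IsDAG.dir_or_dir {D : PDGraph V} (hD : D.IsDAG) {i j : V} (h : D.Adj i j) :
    D.dir i j ∨ D.dir j i := by
  rcases h with h | h | h
  · exact Or.inl h
  · exact Or.inr h
  · exact absurd h (hD.1 _ _)

/-- An active path that has started forwards from a descendant of `k` can never turn: a collider on
it would have a descendant among the parents of `k`, which closes a directed cycle through `k`. -/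
lemma IsDAG.transGen_of_active {D : PDGraph V} (hD : D.IsDAG) {k i : V} :
    ∀ (l : List V) (u w : V), D.DirReach k u → D.dir u w → (u :: w :: l).IsChain D.Adj →
      D.IsActive {z | D.dir z k} (u :: w :: l) → (u :: w :: l).getLast? = some i →
      Relation.TransGen D.dir k i := by
  intro l
  induction l with
  | nil =>
    intro u w hku huw _ _ hl
    obtain rfl : w = i := by simpa using hl
    exact Relation.TransGen.tail' hku huw
  | cons c l ih =>
    intro u w hku huw hch hact hl
    have hwc : D.Adj w c := by
      simp only [List.isChain_cons_cons] at hch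
      exact hch.2.1
    have hkw : D.DirReach k w := Relation.ReflTransGen.tail hku huw
    have hcw : ¬ D.dir c w := by
      intro hcw
      obtain ⟨z, hz, hwz⟩ := (hact u w c ⟨[], l, rfl⟩).1 ⟨huw, hcw⟩
      exact hD.2 k (Relation.TransGen.tail' (hkw.trans hwz) hz)
    have hwc' : D.dir w c := (hD.dir_or_dir hwc).resolve_right hcw
    refine ih w c hkw hwc' ?_ hact.tail ?_
    · simp only [List.isChain_cons_cons] at hch ⊢
      exact hch.2
    · simpa using hl

/-- A node is d-separated by its parents from its non-adjacent non-descendants. -/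
lemma IsDAG.dSep_parents {D : PDGraph V} (hD : D.IsDAG) {k i : V} (hne : k ≠ i)
    (hadj : ¬ D.Adj k i) (hdesc : ¬ Relation.TransGen D.dir k i) :
    D.DSep {k} {i} {z | D.dir z k} := by
  rintro _ rfl _ rfl l ⟨-, hch, hhead, hlast⟩ hact
  match l with
  | [] => simp at hhead
  | [a] =>
    simp at hhead hlast
    exact hne (hhead.symm.trans hlast)
  | a :: m :: t =>
    obtain rfl : a = _ := by simpa using hhead
    have ham : D.Adj a m := by
      simp only [List.isChain_cons_cons] at hch
      exact hch.1
    -- Leaving `k` forwards, the path would make `i` a descendant. Leaving backwards, it is blocked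
    -- at once by a parent of `k`, which is a non-collider in the conditioning set.
    rcases hD.dir_or_dir ham with h | h
    · exact hdesc (hD.transGen_of_active t a m Relation.ReflTransGen.refl h hch hact hlast)
    · match t with
      | [] =>
        obtain rfl : m = _ := by simpa using hlast
        exact hadj ham
      | c :: t =>
        exact (hact a m c ⟨[], t, rfl⟩).2 (fun hc => D.dir_asymm _ _ h hc.1) h

/-- By acyclicity one of the two nodes does not reach the other, and its parents separate. Both
orders appear so that symmetry of d-separation is not needed. -/
lemma IsDAG.exists_dSep {D : PDGraph V} (hD : D.IsDAG) {k i : V} (hne : k ≠ i)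
    (hadj : ¬ D.Adj k i) :
    ∃ Z : Set V, k ∉ Z ∧ i ∉ Z ∧ (D.DSep {k} {i} Z ∨ D.DSep {i} {k} Z) := by
  by_cases h : Relation.TransGen D.dir k i
  · refine ⟨{z | D.dir z i}, fun hk => hadj (Or.inl hk), fun hi => D.dir_asymm _ _ hi hi,
      Or.inr (hD.dSep_parents hne.symm (fun h => hadj h.symm) fun h' => hD.2 k (h.trans h'))⟩
  · exact ⟨{z | D.dir z k}, fun hk => D.dir_asymm _ _ hk hk, fun hi => hadj (Or.inr (Or.inl hi)),
      Or.inl (hD.dSep_parents hne hadj h)⟩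

lemma Adj.not_dSep {D : PDGraph V} {k i : V} (hne : k ≠ i) (h : D.Adj k i) (Z : Set V) :
    ¬ D.DSep {k} {i} Z := by
  intro hs
  refine hs k rfl i rfl [k, i] ⟨by simpa using hne, by simpa using h, rfl, rfl⟩ ?_
  intro a b c habc
  have := habc.length_le
  simp at this

lemma MarkovEquiv.dSep_singleton {D D' : PDGraph V} (h : D.MarkovEquiv D') {k i : V} {Z : Set V}
    (hne : k ≠ i) (hk : k ∉ Z) (hi : i ∉ Z) : D.DSep {k} {i} Z ↔ D'.DSep {k} {i} Z :=
  h _ _ _ (by simpa using hne) (by simpa using hk) (by simpa using hi)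

lemma IsDAG.ne_of_adj {D : PDGraph V} (hD : D.IsDAG) {k i : V} (h : D.Adj k i) : k ≠ i := by
  rintro rfl
  rcases hD.dir_or_dir h with h | h <;> exact D.dir_asymm _ _ h h

lemma MarkovEquiv.adj {D D' : PDGraph V} (h : D.MarkovEquiv D') (hD : D.IsDAG) (hD' : D'.IsDAG)
    {k i : V} (hadj : D.Adj k i) : D'.Adj k i := by
  by_contra hn
  have hne := hD.ne_of_adj hadj
  obtain ⟨Z, hk, hi, hs | hs⟩ := hD'.exists_dSep hne hn
  · exact hadj.not_dSep hne Z ((h.dSep_singleton hne hk hi).2 hs)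
  · exact hadj.symm.not_dSep hne.symm Z ((h.dSep_singleton hne.symm hi hk).2 hs)

/-- The path `a, b, c` must be blocked, and only `b` can block it. Membership of `b` in a separating
set thus detects whether `b` is a collider, which makes v-structures visible to d-separation. -/
lemma dSep_triple {D : PDGraph V} {a b c : V} {Z : Set V} (hab : D.Adj a b)
    (hbc : D.Adj b c) (hab' : a ≠ b) (hbc' : b ≠ c) (hac : a ≠ c) (hs : D.DSep {a} {c} Z) :
    b ∈ Z ↔ ¬ (D.dir a b ∧ D.dir c b) := by
  have hact := hs a rfl c rfl [a, b, c] ⟨by simp [hab', hbc', hac], by simp [hab, hbc], rfl, rfl⟩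
  have key : ∀ x y z, [x, y, z] <:+: [a, b, c] → x = a ∧ y = b ∧ z = c := by
    intro x y z h
    have := h.eq_of_length rfl
    simpa using this
  by_cases hcol : D.dir a b ∧ D.dir c b
  · refine iff_of_false (fun hb => ?_) (not_not.2 hcol)
    refine hact fun x y z h => ?_
    obtain ⟨rfl, rfl, rfl⟩ := key x y z h
    exact ⟨fun _ => ⟨y, hb, Relation.ReflTransGen.refl⟩, fun h => absurd hcol h⟩
  · refine iff_of_true (by_contra fun hb => ?_) hcol
    refine hact fun x y z h => ?_
    obtain ⟨rfl, rfl, rfl⟩ := key x y z h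
    exact ⟨fun h => absurd h hcol, fun _ => hb⟩

/-- Markov equivalent DAGs have the same v-structures. -/
lemma MarkovEquiv.dir_of_collider {D D' : PDGraph V} (h : D.MarkovEquiv D') (hD : D.IsDAG)
    (hD' : D'.IsDAG) {a b c : V} (hab : D.dir a b) (hcb : D.dir c b) (hac : ¬ D'.Adj a c)
    (hne : a ≠ c) : D'.dir c b := by
  by_contra hcon
  have h1 : D.Adj a b := Or.inl hab
  have h2 : D.Adj b c := Or.inr (Or.inl hcb)
  have n1 := hD.ne_of_adj h1
  have n2 := hD.ne_of_adj h2
  have h1' := h.adj hD hD' h1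
  have h2' := h.adj hD hD' h2
  obtain ⟨Z, ha, hc, hs | hs⟩ := hD'.exists_dSep hne hac
  · have e1 := dSep_triple h1 h2 n1 n2 hne ((h.dSep_singleton hne ha hc).2 hs)
    have e2 := dSep_triple h1' h2' n1 n2 hne hs
    exact e1.1 (e2.2 fun hh => hcon hh.2) ⟨hab, hcb⟩
  · have e1 := dSep_triple h2.symm h1.symm n2.symm n1.symm hne.symm
      ((h.dSep_singleton hne.symm hc ha).2 hs)
    have e2 := dSep_triple h2'.symm h1'.symm n2.symm n1.symm hne.symm hs
    exact e1.1 (e2.2 fun hh => hcon hh.1) ⟨hcb, hab⟩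

lemma MarkovEquiv.symm {D D' : PDGraph V} (h : D.MarkovEquiv D') : D'.MarkovEquiv D :=
  fun A B Z h1 h2 h3 => (h A B Z h1 h2 h3).symm

lemma MarkovEquiv.trans {D D' D'' : PDGraph V} (h : D.MarkovEquiv D') (h' : D'.MarkovEquiv D'') :
    D.MarkovEquiv D'' :=
  fun A B Z h1 h2 h3 => (h A B Z h1 h2 h3).trans (h' A B Z h1 h2 h3)

/-! ### SA-MPDAGs are chain graphs whose components have common parents -/

/-- The DAGs of the class share a skeleton, so an edge that does not have this direction in all of
them is reversed in some of them. -/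
lemma IsMPDAGOf.semiStep_of_dir {G D₀ : PDGraph V} {E : Set (V × V)} (hG : G.IsMPDAGOf D₀ E)
    {D : PDGraph V} (hD : D ∈ restrictedClass D₀ E) {i j : V} (h : D.dir i j) :
    G.SemiStep i j := by
  by_cases hall : ∀ D' ∈ restrictedClass D₀ E, D'.dir i j
  · exact Or.inl ((hG.2.2.1 i j).2 hall)
  · push Not at hall
    obtain ⟨D', hD', hn⟩ := hall
    refine Or.inr ((hG.2.2.2 i j).2 ⟨⟨D, hD, h⟩, D', hD', ?_⟩)
    exact (hD'.1.dir_or_dir ((hD.2.1.trans hD'.2.1.symm).adj hD.1 hD'.1 (Or.inl h))).resolve_left hn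

/-- If `i` and `k` are adjacent but not `i → k` in `G`, there is a semi-directed step from `k` to
`i`, and a cycle closes through `j`. If they are not adjacent, a DAG with `k → j` has the
v-structure `i → j ← k`, which a DAG with `j → k` lacks. -/
lemma IsMPDAGOf.dir_of_dir_of_undir {G D₀ : PDGraph V} {E : Set (V × V)} (hG : G.IsMPDAGOf D₀ E)
    (hSA : G.StrictlyAcyclic) {i j k : V} (hij : G.dir i j) (hjk : G.undir j k) : G.dir i k := by
  have hne : i ≠ k := by
    rintro rfl
    exact G.dir_not_undir _ _ hij (G.undir_symm _ _ hjk)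
  by_contra hik
  obtain ⟨⟨D', hD', hjk'⟩, D, hD, hkj⟩ := (hG.2.2.2 j k).1 hjk
  by_cases hadj : D'.Adj i k
  · have : G.SemiStep k i := by
      rcases hD'.1.dir_or_dir hadj with h | h
      · exact Or.inr (G.undir_symm _ _ ((hG.semiStep_of_dir hD' h).resolve_left hik))
      · exact hG.semiStep_of_dir hD' h
    have hjk' : G.SemiStep j k := Or.inr hjk
    exact hSA i j hij ((Relation.ReflTransGen.single hjk').tail this)
  · have := (hD.2.1.trans hD'.2.1.symm).dir_of_collider hD.1 hD'.1
      ((hG.2.2.1 i j).1 hij D hD) hkj hadj hne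
    exact D'.dir_asymm _ _ hjk' this

lemma UndirReach.symm {G : PDGraph V} {i j : V} (h : G.UndirReach i j) : G.UndirReach j i := by
  induction h with
  | refl => exact Relation.ReflTransGen.refl
  | tail _ hbc ih => exact Relation.ReflTransGen.head (G.undir_symm _ _ hbc) ih

lemma UndirReach.dir_of_dir {G : PDGraph V} (hG : G.IsSAMPDAG) {i j k : V}
    (hjk : G.UndirReach j k) (hij : G.dir i j) : G.dir i k := by
  obtain ⟨⟨D₀, E, h⟩, hSA⟩ := hG
  induction hjk with
  | refl => exact hij
  | tail _ hbc ih => exact h.dir_of_dir_of_undir hSA ih hbc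

lemma StrictlyAcyclic.undirReach {G : PDGraph V} (hG : G.StrictlyAcyclic) {i j : V}
    (hij : Relation.ReflTransGen G.SemiStep i j) (hji : Relation.ReflTransGen G.SemiStep j i) :
    G.UndirReach i j := by
  induction hij with
  | refl => exact Relation.ReflTransGen.refl
  | tail hib hbc ih =>
    rcases hbc with h | h
    · exact absurd (hji.trans hib) (hG _ _ h)
    · exact (ih (Relation.ReflTransGen.head (Or.inr h) hji)).tail h

lemma UndirReach.semiReach {G : PDGraph V} {i j : V} (h : G.UndirReach i j) :
    Relation.ReflTransGen G.SemiStep i j :=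
  Relation.ReflTransGen.mono (fun _ _ h => Or.inr h) _ _ h

/-- A rank function of a strictly acyclic graph: constant precisely on the chain components and
increasing along directed edges. -/
lemma StrictlyAcyclic.exists_rank [Finite V] {G : PDGraph V} (hG : G.StrictlyAcyclic) :
    ∃ r : V → ℕ, (∀ i j, G.dir i j → r i < r j) ∧ ∀ i j, r i = r j ↔ G.UndirReach i j := by
  classical
  -- The rank is the position in a linear extension of semi-directed reachability, taken modulo
  -- mutual reachability, whose classes are the chain components.
  let _ : Preorder V :=
    { le := Relation.ReflTransGen G.SemiStep
      le_refl := fun _ => Relation.ReflTransGen.refl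
      le_trans := fun _ _ _ => Relation.ReflTransGen.trans }
  let Q := Antisymmetrization V (· ≤ ·)
  have : Finite Q := Quotient.finite _
  have : Finite (LinearExtension Q) := inferInstanceAs (Finite Q)
  have := Fintype.ofFinite (LinearExtension Q)
  let e := Fintype.orderIsoFinOfCardEq (LinearExtension Q) rfl
  let t : V → LinearExtension Q := fun v => toLinearExtension (toAntisymmetrization (· ≤ ·) v)
  have ht : ∀ i j : V, t i = t j ↔ G.UndirReach i j := by
    intro i j
    have : t i = t j ↔ toAntisymmetrization (· ≤ ·) i = toAntisymmetrization (· ≤ ·) j := Iff.rfl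
    rw [this]
    constructor
    · intro h
      have h' : AntisymmRel (· ≤ ·) i j := Quotient.exact h
      exact hG.undirReach h'.1 h'.2
    · intro h
      exact Quotient.sound ⟨h.semiReach, h.symm.semiReach⟩
  refine ⟨fun v => (e.symm (t v) : ℕ), fun i j hij => ?_, fun i j => ?_⟩
  · have hle : t i ≤ t j := toLinearExtension.monotone
      (show toAntisymmetrization (· ≤ ·) i ≤ toAntisymmetrization (· ≤ ·) j from
        Relation.ReflTransGen.single (Or.inl hij))
    have hne : t i ≠ t j := fun h => hG i j hij ((ht i j).1 h).symm.semiReach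
    have := e.symm.lt_iff_lt.2 (lt_of_le_of_ne hle hne)
    exact this
  · rw [← ht i j, ← Fin.ext_iff, e.symm.injective.eq_iff]

end PDGraph

section LMarginal

variable {V : Type*} [Fintype V] [DecidableEq V] {Ω : V → Type*} [∀ i, MeasurableSpace (Ω i)]

/-! ### Marginal integrals up to null sets -/

lemma dependsOn_mul {f g : (∀ i, Ω i) → ENNReal} {S : Set V} (hf : DependsOn f S)
    (hg : DependsOn g S) : DependsOn (fun v => f v * g v) S :=
  fun x y h => by simp only [hf h, hg h]

lemma dependsOn_div {f g : (∀ i, Ω i) → ENNReal} {S : Set V} (hf : DependsOn f S)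
    (hg : DependsOn g S) : DependsOn (fun v => f v / g v) S :=
  fun x y h => by simp only [hf h, hg h]

lemma dependsOn_inv {f : (∀ i, Ω i) → ENNReal} {S : Set V} (hf : DependsOn f S) :
    DependsOn (fun v => (f v)⁻¹) S :=
  fun x y h => by simp only [hf h]

lemma dependsOn_prod {ι : Type*} {s : Finset ι} {f : ι → (∀ i, Ω i) → ENNReal} {S : Set V}
    (hf : ∀ i ∈ s, DependsOn (f i) S) : DependsOn (fun v => ∏ i ∈ s, f i v) S :=
  fun _ _ h => Finset.prod_congr rfl fun i hi => hf i hi h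

lemma dependsOn_indicator_one {E : Set (∀ i, Ω i)} {S : Set V}
    (h : ∀ x y : ∀ i, Ω i, (∀ i ∈ S, x i = y i) → (x ∈ E ↔ y ∈ E)) :
    DependsOn (E.indicator (1 : (∀ i, Ω i) → ENNReal)) S := by
  intro x y hxy
  by_cases hx : x ∈ E
  · simp [hx, (h x y hxy).1 hx]
  · have hy : y ∉ E := fun hy => hx ((h x y hxy).2 hy)
    simp [hx, hy]

lemma dependsOn_lmarginal (μ : ∀ i, Measure (Ω i)) {f : (∀ i, Ω i) → ENNReal} {T : Finset V}
    (S : Finset V) (hf : DependsOn f (T : Set V)) :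
    DependsOn (lmarginal μ S f) (↑(T \ S) : Set V) := by
  intro x y h
  refine lintegral_congr fun z => hf fun i hi => ?_
  by_cases hS : i ∈ S
  · simp [Function.updateFinset, hS]
  · simp only [Function.updateFinset, hS, dite_false]
    exact h i (by simpa [hS] using hi)

lemma lmarginal_mul_left (μ : ∀ i, Measure (Ω i)) {f g : (∀ i, Ω i) → ENNReal} {S T : Finset V}
    (hf : DependsOn f (T : Set V)) (hST : Disjoint S T) (hg : Measurable g) :
    lmarginal μ S (fun v => f v * g v) = fun v => f v * lmarginal μ S g v := by
  ext v
  refine Eq.trans ?_ (lintegral_const_mul (f v) (hg.comp measurable_updateFinset))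
  refine lintegral_congr fun z => ?_
  have : f (Function.updateFinset v S z) = f v := ?_
  · simp only [this]
  refine hf fun i hi => ?_
  have : i ∉ S := fun h => Finset.disjoint_left.1 hST h hi
  simp [Function.updateFinset, this]

variable (μ : ∀ i, Measure (Ω i)) [∀ i, SigmaFinite (μ i)]

lemma lmarginal_eq_lmarginal_lmarginal {f : (∀ i, Ω i) → ENNReal} (hf : Measurable f)
    {R S T : Finset V} (hRS : Disjoint R S) (hT : R ∪ S = T) :
    lmarginal μ T f = lmarginal μ R (lmarginal μ S f) := by
  rw [← hT, lmarginal_union μ f hf hRS]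

lemma lmarginal_compl_lmarginal {f : (∀ i, Ω i) → ENNReal} (hf : Measurable f) (S : Finset V) :
    lmarginal μ Sᶜ (lmarginal μ S f) = fun _ => ∫⁻ v, f v ∂(Measure.pi μ) := by
  rw [← lmarginal_eq_lmarginal_lmarginal μ hf (R := Sᶜ) (S := S) (T := Finset.univ)
    disjoint_compl_left (by rw [Finset.union_comm, Finset.union_compl]),
    lmarginal_univ]

/-- The total integral of the marginal integrates over `S` twice. The second time the integrand is
the constant `∫ f = 0`, so a possibly infinite mass of the reference measure does no harm. -/
lemma lmarginal_ae_eq_zero {f : (∀ i, Ω i) → ENNReal} (hf : Measurable f)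
    (h : f =ᵐ[Measure.pi μ] 0) (S : Finset V) : lmarginal μ S f =ᵐ[Measure.pi μ] 0 := by
  rcases isEmpty_or_nonempty (∀ i, Ω i) with he | ⟨⟨x⟩⟩
  · exact Filter.Eventually.of_forall fun v => (he.false v).elim
  rw [← lintegral_eq_zero_iff (hf.lmarginal μ), lintegral_eq_lmarginal_univ x,
    lmarginal_eq_lmarginal_lmarginal μ (hf.lmarginal μ) (R := S) (S := Sᶜ) disjoint_compl_right
      (by simp), lmarginal_compl_lmarginal μ hf, lintegral_congr_ae h]
  simp [lmarginal]

lemma lmarginal_congr_ae {f g : (∀ i, Ω i) → ENNReal} (hf : Measurable f) (hg : Measurable g)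
    (h : f =ᵐ[Measure.pi μ] g) (S : Finset V) :
    lmarginal μ S f =ᵐ[Measure.pi μ] lmarginal μ S g := by
  have hN : MeasurableSet {v | f v ≠ g v} := (measurableSet_eq_fun hf hg).compl
  have hm : Measurable ({v | f v ≠ g v}.indicator (1 : (∀ i, Ω i) → ENNReal)) :=
    measurable_one.indicator hN
  have h0 : {v | f v ≠ g v}.indicator (1 : (∀ i, Ω i) → ENNReal) =ᵐ[Measure.pi μ] 0 := by
    filter_upwards [h] with v hv
    simp [hv]
  filter_upwards [lmarginal_ae_eq_zero μ hm h0 S] with v hv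
  have := (lintegral_eq_zero_iff (hm.comp measurable_updateFinset)).1 hv
  refine lintegral_congr_ae ?_
  filter_upwards [this] with y hy
  by_contra hne
  simp [hne] at hy

lemma lmarginal_mono_ae {f g : (∀ i, Ω i) → ENNReal} (hf : Measurable f) (hg : Measurable g)
    (h : f ≤ᵐ[Measure.pi μ] g) (S : Finset V) :
    lmarginal μ S f ≤ᵐ[Measure.pi μ] lmarginal μ S g := by
  have h1 : (fun v => f v ⊔ g v) =ᵐ[Measure.pi μ] g := by
    filter_upwards [h] with v hv
    exact sup_eq_right.2 hv
  filter_upwards [lmarginal_congr_ae μ (hf.sup hg) hg h1 S] with v hv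
  exact (lmarginal_mono (μ := μ) (s := S) (fun v => le_sup_left (b := g v)) v).trans hv.le

lemma ae_eq_zero_of_lmarginal_ae_eq_zero {f : (∀ i, Ω i) → ENNReal} (hf : Measurable f)
    {S : Finset V} (h : lmarginal μ S f =ᵐ[Measure.pi μ] 0) : f =ᵐ[Measure.pi μ] 0 := by
  have h1 := lmarginal_ae_eq_zero μ (hf.lmarginal μ) h Sᶜ
  rw [lmarginal_compl_lmarginal μ hf] at h1
  by_cases h0 : Measure.pi μ = 0
  · simp [h0, Filter.EventuallyEq]
  · have : (ae (Measure.pi μ)).NeBot := ae_neBot.2 h0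
    obtain ⟨v, hv⟩ := h1.exists
    exact (lintegral_eq_zero_iff hf).1 hv

lemma ae_lt_top_of_lmarginal {f : (∀ i, Ω i) → ENNReal} (hf : Measurable f)
    {S : Finset V} (h : ∀ᵐ v ∂(Measure.pi μ), lmarginal μ S f v < ⊤) :
    ∀ᵐ v ∂(Measure.pi μ), f v < ⊤ := by
  have hE : MeasurableSet {v | f v = ⊤} := hf (measurableSet_singleton ⊤)
  have hm : Measurable ({v | f v = ⊤}.indicator (1 : (∀ i, Ω i) → ENNReal)) :=
    measurable_one.indicator hE
  have hle : (fun v => ⊤ * {v | f v = ⊤}.indicator (1 : (∀ i, Ω i) → ENNReal) v) ≤ f := by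
    intro v
    by_cases hv : f v = ⊤ <;> simp [hv]
  have h0 : lmarginal μ S ({v | f v = ⊤}.indicator 1) =ᵐ[Measure.pi μ] 0 := by
    filter_upwards [h] with v hv
    have h1 := (lmarginal_mono (μ := μ) (s := S) hle v).trans_lt hv
    rw [lmarginal_mul_left μ (f := fun _ => ⊤) (T := ∅) (fun _ _ _ => rfl) (by simp) hm] at h1
    beta_reduce at h1
    by_contra hne
    rw [ENNReal.top_mul hne] at h1
    exact lt_irrefl _ h1
  filter_upwards [ae_eq_zero_of_lmarginal_ae_eq_zero μ hm h0] with v hv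
  by_contra hne
  simp [not_lt_top_iff.1 hne] at hv

/-- Comparable functions with the same finite marginal integrals agree almost everywhere. -/
lemma ae_eq_of_ae_le_of_lmarginal_le {f g : (∀ i, Ω i) → ENNReal} (hf : Measurable f)
    (hg : Measurable g) (hfg : f ≤ᵐ[Measure.pi μ] g) {S : Finset V}
    (hle : lmarginal μ S g ≤ᵐ[Measure.pi μ] lmarginal μ S f)
    (hfin : ∀ᵐ v ∂(Measure.pi μ), lmarginal μ S f v < ⊤) : f =ᵐ[Measure.pi μ] g := by
  have hd : Measurable fun v => g v - f v := hg.sub hf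
  have h1 : g =ᵐ[Measure.pi μ] fun v => f v + (g v - f v) := by
    filter_upwards [hfg] with v hv
    exact (add_tsub_cancel_of_le hv).symm
  have h2 : lmarginal μ S (fun v => g v - f v) =ᵐ[Measure.pi μ] 0 := by
    filter_upwards [lmarginal_congr_ae μ hg (g := fun v => f v + (g v - f v)) (hf.add hd) h1 S, hle,
      hfin] with v hv hv' hv''
    rw [hv] at hv'
    have hadd : lmarginal μ S (fun v => f v + (g v - f v)) v =
        lmarginal μ S f v + lmarginal μ S (fun v => g v - f v) v :=
      lintegral_add_left (hf.comp measurable_updateFinset) _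
    rw [hadd] at hv'
    by_contra hne
    exact absurd hv' (not_le.2 (ENNReal.lt_add_right hv''.ne hne))
  filter_upwards [hfg, ae_eq_zero_of_lmarginal_ae_eq_zero μ hd h2] with v hv hv'
  exact le_antisymm hv (tsub_eq_zero_iff_le.1 hv')

/-! ### Marginal and conditional densities -/

variable {μ} {p : (∀ i, Ω i) → ENNReal}

lemma measurable_margDensity (hp : Measurable p) (S : Finset V) :
    Measurable (margDensity μ p S) := hp.lmarginal μ

lemma dependsOn_margDensity (S : Finset V) : DependsOn (margDensity μ p S) (S : Set V) := by
  have := dependsOn_lmarginal μ (T := Finset.univ) Sᶜ (f := p)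
    (by simpa using dependsOn_univ p)
  rwa [← Finset.compl_eq_univ_sdiff, compl_compl] at this

lemma measurable_condDensity (hp : Measurable p) (B S : Finset V) :
    Measurable (condDensity μ p B S) :=
  (measurable_margDensity hp _).div (measurable_margDensity hp _)

lemma dependsOn_condDensity (B S : Finset V) :
    DependsOn (condDensity μ p B S) (↑(B ∪ S) : Set V) :=
  dependsOn_div (dependsOn_margDensity _) ((dependsOn_margDensity _).mono (by simp))

lemma lmarginal_margDensity (hp : Measurable p) {R T U : Finset V} (hR : R ⊆ T)
    (hU : T \ R = U) : lmarginal μ R (margDensity μ p T) = margDensity μ p U := by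
  unfold margDensity
  refine (lmarginal_eq_lmarginal_lmarginal μ hp ?_ ?_).symm
  · exact disjoint_compl_right.mono_left hR
  · ext i
    simp [← hU]
    tauto

lemma margDensity_univ : margDensity μ p Finset.univ = p := by
  simp [margDensity]

lemma margDensity_empty (hp : IsJointDensity μ p) (v : ∀ i, Ω i) : margDensity μ p ∅ v = 1 := by
  simp [margDensity, hp.2]

lemma ae_margDensity_lt_top (hp : IsJointDensity μ p) (S : Finset V) :
    ∀ᵐ v ∂(Measure.pi μ), margDensity μ p S v < ⊤ := by
  refine ae_lt_top_of_lmarginal μ (measurable_margDensity hp.1 S) (S := S) ?_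
  rw [lmarginal_margDensity hp.1 (U := ∅) le_rfl (by simp)]
  exact Filter.Eventually.of_forall fun v => by simp [margDensity_empty hp v]

/-- Integrating the density of `T`, restricted to the zeros of the density of `S`, over `T \ S`
gives zero. This is what makes the convention `0/0 = 0` harmless in products with a density. -/
lemma ae_margDensity_eq_zero (hp : Measurable p) {S T : Finset V} (hST : S ⊆ T) :
    ∀ᵐ v ∂(Measure.pi μ), margDensity μ p S v = 0 → margDensity μ p T v = 0 := by
  have hE : MeasurableSet {v | margDensity μ p S v = 0} :=
    measurable_margDensity hp S (measurableSet_singleton 0)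
  have hm : Measurable ({v | margDensity μ p S v = 0}.indicator (1 : (∀ i, Ω i) → ENNReal)) :=
    measurable_one.indicator hE
  have hdep : DependsOn ({v | margDensity μ p S v = 0}.indicator (1 : (∀ i, Ω i) → ENNReal))
      (S : Set V) :=
    dependsOn_indicator_one fun x y h => by
      simp only [Set.mem_ofPred_eq, dependsOn_margDensity S h]
  have h0 : lmarginal μ (T \ S) (fun v => {v | margDensity μ p S v = 0}.indicator 1 v *
      margDensity μ p T v) =ᵐ[Measure.pi μ] 0 := by
    rw [lmarginal_mul_left μ hdep Finset.sdiff_disjoint (measurable_margDensity hp T),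
      lmarginal_margDensity hp Finset.sdiff_subset (Finset.sdiff_sdiff_eq_self hST)]
    refine Filter.Eventually.of_forall fun v => ?_
    by_cases hv : margDensity μ p S v = 0 <;> simp [hv]
  filter_upwards [ae_eq_zero_of_lmarginal_ae_eq_zero μ
    (hm.mul (measurable_margDensity hp T)) h0] with v hv hS
  simpa [hS] using hv

lemma ae_condDensity_lt_top (hp : IsJointDensity μ p) (B S : Finset V) :
    ∀ᵐ v ∂(Measure.pi μ), condDensity μ p B S v < ⊤ := by
  filter_upwards [ae_margDensity_lt_top hp (B ∪ S),
    ae_margDensity_eq_zero hp.1 (Finset.subset_union_right (s₁ := B) (s₂ := S))] with v h1 h2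
  unfold condDensity
  by_cases h : margDensity μ p S v = 0
  · simp [h, h2 h]
  · exact ENNReal.div_lt_top h1.ne h

lemma lmarginal_condDensity (hp : Measurable p) {B R S B' : Finset V} (hR : R ⊆ B)
    (hRS : Disjoint R S) (hB' : B \ R = B') :
    lmarginal μ R (condDensity μ p B S) = condDensity μ p B' S := by
  have h1 : condDensity μ p B S =
      fun v => (margDensity μ p S v)⁻¹ * margDensity μ p (B ∪ S) v := by
    ext v
    rw [condDensity, ENNReal.div_eq_inv_mul]
  rw [h1, lmarginal_mul_left μ (dependsOn_inv (dependsOn_margDensity S)) hRS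
    (measurable_margDensity hp _), lmarginal_margDensity hp (U := B' ∪ S)
      (hR.trans Finset.subset_union_left)]
  · ext v
    rw [condDensity, ENNReal.div_eq_inv_mul]
  · rw [← hB', Finset.union_sdiff_distrib, Finset.sdiff_eq_self_of_disjoint hRS.symm]

lemma condDensity_empty_left (S : Finset V) (v : ∀ i, Ω i) :
    condDensity μ p ∅ S v = margDensity μ p S v / margDensity μ p S v := by
  simp [condDensity]

/-- The integral is the quotient of the density of `S` by itself, which is 0 rather than 1 where
that density is 0 or infinite; hence only an inequality. -/
lemma lmarginal_condDensity_le_one (hp : Measurable p) {B S : Finset V} (hBS : Disjoint B S)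
    (v : ∀ i, Ω i) : lmarginal μ B (condDensity μ p B S) v ≤ 1 := by
  rw [lmarginal_condDensity hp le_rfl hBS (sdiff_self (a := B)), Finset.bot_eq_empty,
    condDensity_empty_left]
  exact ENNReal.div_self_le_one

lemma margDensity_mul_condDensity_empty (hp : IsJointDensity μ p) {S U : Finset V} (hSU : S ⊆ U) :
    (fun v => margDensity μ p U v * condDensity μ p ∅ S v) =ᵐ[Measure.pi μ] margDensity μ p U := by
  filter_upwards [ae_margDensity_lt_top hp S, ae_margDensity_eq_zero hp.1 hSU] with v h1 h2
  rw [condDensity_empty_left]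
  by_cases h : margDensity μ p S v = 0
  · simp [h2 h]
  · rw [ENNReal.div_self h h1.ne, mul_one]

/-- If the joint density of `U ∪ B` is that of `U` times a function of `B ∪ S` with `S ⊆ U`, then
this function may be taken to be the conditional density of `B` given `S`. -/
lemma margDensity_union_of_factor (hp : IsJointDensity μ p) {U B S : Finset V} (hSU : S ⊆ U)
    (hUB : Disjoint U B) {q : (∀ i, Ω i) → ENNReal} (hq : Measurable q)
    (hdep : DependsOn q (↑(B ∪ S) : Set V))
    (h : margDensity μ p (U ∪ B) =ᵐ[Measure.pi μ] fun v => margDensity μ p U v * q v) :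
    margDensity μ p (U ∪ B) =ᵐ[Measure.pi μ]
      fun v => margDensity μ p U v * condDensity μ p B S v := by
  have hmU := measurable_margDensity (μ := μ) hp.1 U
  -- Integrating the factorization over `U \ S` leaves `q` untouched and identifies it where the
  -- density of `S` is non-zero.
  have h1 : margDensity μ p (B ∪ S) =ᵐ[Measure.pi μ] fun v => q v * margDensity μ p S v := by
    have h2 := lmarginal_congr_ae μ (measurable_margDensity hp.1 _)
      (g := fun v => margDensity μ p U v * q v) (hmU.mul hq) h (U \ S)
    rw [lmarginal_margDensity hp.1 (U := B ∪ S)] at h2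
    · refine h2.trans (Filter.EventuallyEq.of_eq ?_)
      simp_rw [mul_comm (margDensity μ p U _)]
      rw [lmarginal_mul_left μ hdep _ hmU,
        lmarginal_margDensity hp.1 Finset.sdiff_subset (Finset.sdiff_sdiff_eq_self hSU)]
      rw [Finset.disjoint_union_right]
      exact ⟨hUB.mono_left Finset.sdiff_subset, Finset.sdiff_disjoint⟩
    · exact Finset.sdiff_subset.trans Finset.subset_union_left
    · rw [Finset.union_sdiff_distrib, Finset.sdiff_sdiff_eq_self hSU, Finset.union_comm,
        Finset.sdiff_eq_self_of_disjoint (hUB.symm.mono_right Finset.sdiff_subset)]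
  filter_upwards [h, h1, ae_margDensity_lt_top hp S, ae_margDensity_eq_zero hp.1 hSU]
    with v e e1 hfin hzero
  rw [e]
  by_cases hS : margDensity μ p S v = 0
  · simp [hzero hS]
  · rw [condDensity, e1, ENNReal.mul_div_cancel_right hS hfin.ne]

/-- Conditional independence passes to subsets: the variables in `B \ B'` and then those in `U \ U'`
are integrated out, which is possible because `S` stays inside `U'`. -/
lemma margDensity_union_mono (hp : IsJointDensity μ p) {U B S U' B' : Finset V}
    (hSU : S ⊆ U') (hU : U' ⊆ U) (hB : B' ⊆ B) (hUB : Disjoint U B)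
    (h : margDensity μ p (U ∪ B) =ᵐ[Measure.pi μ]
      fun v => margDensity μ p U v * condDensity μ p B S v) :
    margDensity μ p (U' ∪ B') =ᵐ[Measure.pi μ]
      fun v => margDensity μ p U' v * condDensity μ p B' S v := by
  have hmU := measurable_margDensity (μ := μ) hp.1 U
  have hmB := measurable_condDensity (μ := μ) hp.1 B S
  have hmB' := measurable_condDensity (μ := μ) hp.1 B' S
  have hd := Finset.disjoint_left.1 hUB
  have h1 : margDensity μ p (U ∪ B') =ᵐ[Measure.pi μ]
      fun v => margDensity μ p U v * condDensity μ p B' S v := by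
    have h2 := lmarginal_congr_ae μ (measurable_margDensity hp.1 _)
      (g := fun v => margDensity μ p U v * condDensity μ p B S v) (hmU.mul hmB) h (B \ B')
    rwa [lmarginal_margDensity hp.1 (U := U ∪ B'),
      lmarginal_mul_left μ (dependsOn_margDensity U) _ hmB, lmarginal_condDensity hp.1
        Finset.sdiff_subset _ (Finset.sdiff_sdiff_eq_self hB)] at h2
    · rw [Finset.disjoint_left]
      intro i hi hiS
      exact hd (hU (hSU hiS)) (Finset.mem_sdiff.1 hi).1
    · exact hUB.symm.mono_left Finset.sdiff_subset
    · exact Finset.sdiff_subset.trans Finset.subset_union_right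
    · ext i
      have := @hd i
      have := @hB i
      simp
      tauto
  have h2 := lmarginal_congr_ae μ (measurable_margDensity hp.1 _)
      (g := fun v => margDensity μ p U v * condDensity μ p B' S v) (hmU.mul hmB') h1 (U \ U')
  simp_rw [mul_comm (margDensity μ p U _)] at h2
  rw [lmarginal_margDensity hp.1 (U := U' ∪ B'),
    lmarginal_mul_left μ (dependsOn_condDensity B' S) _ hmU,
    lmarginal_margDensity hp.1 Finset.sdiff_subset (Finset.sdiff_sdiff_eq_self hU)] at h2
  · simpa only [mul_comm] using h2
  · rw [Finset.disjoint_left]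
    intro i hi hi'
    rcases Finset.mem_union.1 hi' with h' | h'
    · exact hd (Finset.mem_sdiff.1 hi).1 (hB h')
    · exact (Finset.mem_sdiff.1 hi).2 (hSU h')
  · exact Finset.sdiff_subset.trans Finset.subset_union_left
  · ext i
    have := @hd i
    have := @hB i
    have := @hU i
    simp
    tauto

end LMarginal

section ChainRule

variable {V : Type*} [Fintype V] [DecidableEq V] {Ω : V → Type*} [∀ i, MeasurableSpace (Ω i)]
  {μ : ∀ i, Measure (Ω i)} [∀ i, SigmaFinite (μ i)] {p : (∀ i, Ω i) → ENNReal}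

namespace PDGraph

/-! ### Markovian densities factorize over ancestral sets -/

lemma mem_pa {G : PDGraph V} {D : Finset V} {i : V} : i ∈ G.pa D ↔ ∃ j ∈ D, G.dir i j := by
  simp [pa]

lemma mem_an {G : PDGraph V} {D : Finset V} {i : V} : i ∈ G.an D ↔ ∃ j ∈ D, G.DirReach i j := by
  simp [an]

lemma pa_empty (G : PDGraph V) : G.pa ∅ = ∅ := by
  ext i
  simp [mem_pa]

/-- The node set `U` contains the parents of its elements. -/
def IsAncestral (G : PDGraph V) (U : Finset V) : Prop := ∀ i j, G.dir i j → j ∈ U → i ∈ U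

lemma IsAncestral.pa_subset {G : PDGraph V} {U D : Finset V} (hU : G.IsAncestral U) (hD : D ⊆ U) :
    G.pa D ⊆ U := by
  intro i hi
  obtain ⟨j, hj, hij⟩ := mem_pa.1 hi
  exact hU i j hij (hD hj)

lemma IsDAG.exists_minimal {D : PDGraph V} (hD : D.IsDAG) {S : Finset V} (hS : S.Nonempty) :
    ∃ i ∈ S, ∀ j ∈ S, ¬ D.dir j i := by
  have : Std.Irrefl (Relation.TransGen D.dir) := ⟨hD.2⟩
  have hwf := Finite.wellFounded_of_trans_of_irrefl (Relation.TransGen D.dir)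
  obtain ⟨i, hi, hmin⟩ := hwf.has_min (S : Set V) hS
  exact ⟨i, hi, fun j hj h => hmin j hj (Relation.TransGen.single h)⟩

lemma IsDAG.exists_maximal {D : PDGraph V} (hD : D.IsDAG) {S : Finset V} (hS : S.Nonempty) :
    ∃ i ∈ S, ∀ j ∈ S, ¬ D.dir i j := by
  have : Std.Irrefl (Function.swap (Relation.TransGen D.dir)) := ⟨hD.2⟩
  have : IsTrans V (Function.swap (Relation.TransGen D.dir)) := ⟨fun _ _ _ h h' => h'.trans h⟩
  have hwf := Finite.wellFounded_of_trans_of_irrefl (Function.swap (Relation.TransGen D.dir))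
  obtain ⟨i, hi, hmin⟩ := hwf.has_min (S : Set V) hS
  exact ⟨i, hi, fun j hj h => hmin j hj (Relation.TransGen.single h)⟩

lemma IsDAG.notMem_pa {D : PDGraph V} (i : V) : i ∉ D.pa {i} := by
  simp only [mem_pa, Finset.mem_singleton, exists_eq_left]
  exact fun h => D.dir_asymm _ _ h h

/-- Product of the conditional densities of the nodes in `W` given their parents. -/
def condProd (D : PDGraph V) (μ : ∀ i, Measure (Ω i)) (p : (∀ i, Ω i) → ENNReal) (W : Finset V)
    (v : ∀ i, Ω i) : ENNReal :=
  ∏ i ∈ W, condDensity μ p {i} (D.pa {i}) v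

lemma measurable_condProd (D : PDGraph V) (hp : Measurable p) (W : Finset V) :
    Measurable (D.condProd μ p W) :=
  Finset.measurable_fun_prod _ fun _ _ => measurable_condDensity hp _ _

lemma dependsOn_condProd (D : PDGraph V) {W S : Finset V} (hW : W ⊆ S) (hpa : D.pa W ⊆ S) :
    DependsOn (D.condProd μ p W) (S : Set V) := by
  refine dependsOn_prod fun i hi => (dependsOn_condDensity _ _).mono ?_
  rw [Finset.coe_subset]
  refine Finset.union_subset (by simpa using hW hi) fun j hj => hpa ?_
  simp only [mem_pa, Finset.mem_singleton, exists_eq_left] at hj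
  exact mem_pa.2 ⟨i, hi, hj⟩

/-- Since `W` is ancestral and omits `i`, only the factor of `i` involves this coordinate. -/
lemma lmarginal_condProd_insert_le {D : PDGraph V} (hp : Measurable p) {W : Finset V}
    (hW : D.IsAncestral W) {i : V} (hi : i ∉ W) (v : ∀ i, Ω i) :
    lmarginal μ {i} (D.condProd μ p (insert i W)) v ≤ D.condProd μ p W v := by
  have h : D.condProd μ p (insert i W) =
      fun v => D.condProd μ p W v * condDensity μ p {i} (D.pa {i}) v := by
    ext v
    rw [condProd, Finset.prod_insert hi, mul_comm, condProd]
  rw [h, lmarginal_mul_left μ (D.dependsOn_condProd le_rfl (hW.pa_subset le_rfl)) (by simpa using hi)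
    (measurable_condDensity hp _ _)]
  calc _ ≤ D.condProd μ p W v * 1 :=
        mul_le_mul_right (lmarginal_condDensity_le_one hp (by simpa using IsDAG.notMem_pa i) v) _
    _ = _ := mul_one _

lemma lmarginal_condProd_le_one {D : PDGraph V} (hD : D.IsDAG) (hp : Measurable p)
    (W : Finset V) (hW : D.IsAncestral W) (v : ∀ i, Ω i) :
    lmarginal μ W (D.condProd μ p W) v ≤ 1 := by
  induction hn : W.card generalizing W with
  | zero =>
    rw [Finset.card_eq_zero] at hn
    simp [hn, condProd]
  | succ n ih =>
    -- A node without children in `W` can be removed with `W` remaining ancestral.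
    obtain ⟨i, hi, hmax⟩ := hD.exists_maximal (S := W) (Finset.card_pos.1 (by omega))
    have hW' : D.IsAncestral (W.erase i) := by
      intro a b hab hb
      refine Finset.mem_erase.2 ⟨?_, hW a b hab (Finset.mem_of_mem_erase hb)⟩
      rintro rfl
      exact hmax b (Finset.mem_of_mem_erase hb) hab
    have hle := lmarginal_condProd_insert_le (μ := μ) hp hW' (Finset.notMem_erase i W)
    rw [Finset.insert_erase hi] at hle
    rw [lmarginal_eq_lmarginal_lmarginal μ (D.measurable_condProd hp W) (R := W.erase i)
      (S := {i}) (by simp) (by rw [Finset.union_comm]; exact Finset.insert_erase hi)]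
    refine (lmarginal_mono (s := W.erase i) hle v).trans (ih _ hW' ?_)
    rw [Finset.card_erase_of_mem hi, hn, Nat.add_sub_cancel]

/-- Starting from the Markov factorization on all nodes, the nodes outside `W` are integrated out
one at a time, children before parents. -/
lemma margDensity_le_condProd {D : PDGraph V} (hD : D.IsDAG) (hp : Measurable p)
    (hM : D.IsMarkovian μ p) (W : Finset V) (hW : D.IsAncestral W) :
    margDensity μ p W ≤ᵐ[Measure.pi μ] D.condProd μ p W := by
  induction hn : Wᶜ.card generalizing W with
  | zero =>
    rw [Finset.card_eq_zero, Finset.compl_eq_empty_iff] at hn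
    subst hn
    rw [margDensity_univ]
    filter_upwards [hM] with v hv
    exact hv.le
  | succ n ih =>
    obtain ⟨i, hi, hmin⟩ := hD.exists_minimal (S := Wᶜ) (Finset.card_pos.1 (by omega))
    rw [Finset.mem_compl] at hi
    have hW' : D.IsAncestral (insert i W) := by
      intro a b hab hb
      rcases Finset.mem_insert.1 hb with rfl | hb
      · by_contra ha
        exact hmin a (Finset.mem_compl.2 fun h => ha (Finset.mem_insert_of_mem h)) hab
      · exact Finset.mem_insert_of_mem (hW a b hab hb)
    have h1 := lmarginal_mono_ae μ (measurable_margDensity hp _) (D.measurable_condProd hp _)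
      (ih _ hW' (by rw [Finset.compl_insert, Finset.card_erase_of_mem (by simpa using hi), hn,
        Nat.add_sub_cancel])) {i}
    rw [lmarginal_margDensity hp (R := {i}) (T := insert i W) (U := W) (by simp)
      (by rw [Finset.sdiff_singleton_eq_erase, Finset.erase_insert hi])] at h1
    filter_upwards [h1] with v hv
    exact hv.trans (lmarginal_condProd_insert_le hp hW hi v)

/-- The smaller side integrates to exactly 1 and the larger to at most 1, so they agree almost
everywhere. -/
lemma margDensity_ae_eq_condProd {D : PDGraph V} (hD : D.IsDAG) (hp : IsJointDensity μ p)
    (hM : D.IsMarkovian μ p) (W : Finset V) (hW : D.IsAncestral W) :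
    margDensity μ p W =ᵐ[Measure.pi μ] D.condProd μ p W := by
  have h1 : lmarginal μ W (margDensity μ p W) = 1 := by
    rw [lmarginal_margDensity hp.1 (U := ∅) le_rfl (by simp)]
    exact funext (margDensity_empty hp)
  refine ae_eq_of_ae_le_of_lmarginal_le μ (measurable_margDensity hp.1 W)
    (D.measurable_condProd hp.1 W) (margDensity_le_condProd hD hp.1 hM W hW) (S := W) ?_ ?_
  · rw [h1]
    exact Filter.Eventually.of_forall (lmarginal_condProd_le_one hD hp.1 W hW)
  · simp [h1]

lemma margDensity_union_of_isMarkovian {D : PDGraph V} (hD : D.IsDAG) (hp : IsJointDensity μ p)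
    (hM : D.IsMarkovian μ p) {U B S : Finset V} (hU : D.IsAncestral U)
    (hUB : D.IsAncestral (U ∪ B)) (hdisj : Disjoint U B) (hSU : S ⊆ U) (hpa : D.pa B ⊆ B ∪ S) :
    margDensity μ p (U ∪ B) =ᵐ[Measure.pi μ]
      fun v => margDensity μ p U v * condDensity μ p B S v := by
  refine margDensity_union_of_factor hp hSU hdisj (q := D.condProd μ p B)
    (D.measurable_condProd hp.1 B)
    (D.dependsOn_condProd Finset.subset_union_left hpa) ?_
  filter_upwards [margDensity_ae_eq_condProd hD hp hM U hU,
    margDensity_ae_eq_condProd hD hp hM _ hUB] with v h1 h2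
  rw [h1, h2, condProd, Finset.prod_union hdisj, condProd, condProd]

/-! ### Levels of a rank function -/

/-- The nodes of `S` of rank `k`. -/
def level (r : V → ℕ) (S : Finset V) (k : ℕ) : Finset V := S.filter fun i => r i = k

/-- The nodes of `S` of rank less than `k`. -/
def below (r : V → ℕ) (S : Finset V) (k : ℕ) : Finset V := S.filter fun i => r i < k

lemma mem_level {r : V → ℕ} {S : Finset V} {k : ℕ} {i : V} :
    i ∈ level r S k ↔ i ∈ S ∧ r i = k := Finset.mem_filter

lemma mem_below {r : V → ℕ} {S : Finset V} {k : ℕ} {i : V} :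
    i ∈ below r S k ↔ i ∈ S ∧ r i < k := Finset.mem_filter

lemma below_union_level (r : V → ℕ) (S : Finset V) (k : ℕ) :
    below r S k ∪ level r S k = below r S (k + 1) := by
  ext i
  simp only [Finset.mem_union, mem_below, mem_level, Nat.lt_succ_iff_lt_or_eq]
  tauto

lemma disjoint_below_level (r : V → ℕ) (S : Finset V) (k : ℕ) :
    Disjoint (below r S k) (level r S k) := by
  rw [Finset.disjoint_left]
  intro i h h'
  have := (mem_below.1 h).2
  have := (mem_level.1 h').2
  omega

lemma mem_chainDecomp_iff {G : PDGraph V} {r : V → ℕ} (hr : ∀ i j, r i = r j ↔ G.UndirReach i j)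
    {S B : Finset V} : B ∈ G.chainDecomp S ↔ B.Nonempty ∧ ∃ k, level r S k = B := by
  have hcomp : ∀ v, S ∩ G.chainComponent v = level r S (r v) := by
    intro v
    ext i
    simp [chainComponent, mem_level, ← hr, eq_comm]
  simp only [chainDecomp, chainComponents, Finset.mem_filter, Finset.mem_image, Finset.mem_univ,
    true_and, exists_exists_eq_and, hcomp]
  constructor
  · rintro ⟨⟨v, rfl⟩, h⟩
    exact ⟨h, r v, rfl⟩
  · rintro ⟨h, k, rfl⟩
    obtain ⟨i, hi⟩ := h
    exact ⟨⟨i, by rw [(mem_level.1 hi).2]⟩, i, hi⟩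

/-- Indexing by rank puts the factors of different sets on a common scale; `f ∅ = 1` absorbs the
ranks that `S` misses. -/
lemma prod_chainDecomp {G : PDGraph V} {r : V → ℕ} (hr : ∀ i j, r i = r j ↔ G.UndirReach i j)
    {K : ℕ} (hK : ∀ i, r i < K) (S : Finset V) (f : Finset V → ENNReal) (hf : f ∅ = 1) :
    ∏ B ∈ G.chainDecomp S, f B = ∏ k ∈ Finset.range K, f (level r S k) := by
  have himg : G.chainDecomp S =
      ((Finset.range K).filter fun k => (level r S k).Nonempty).image (level r S) := by
    ext B
    simp only [mem_chainDecomp_iff hr, Finset.mem_image, Finset.mem_filter, Finset.mem_range]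
    constructor
    · rintro ⟨⟨i, hi⟩, k, rfl⟩
      exact ⟨k, ⟨(mem_level.1 hi).2 ▸ hK i, i, hi⟩, rfl⟩
    · rintro ⟨k, ⟨-, h⟩, rfl⟩
      exact ⟨h, k, rfl⟩
  rw [himg, Finset.prod_image, Finset.prod_filter]
  · refine Finset.prod_congr rfl fun k _ => ?_
    split_ifs with h
    · rfl
    · rw [Finset.not_nonempty_iff_eq_empty.1 h, hf]
  · intro k hk l hl hkl
    obtain ⟨i, hi⟩ := (Finset.mem_filter.1 hk).2
    have hi' : i ∈ level r S l := hkl ▸ hi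
    exact (mem_level.1 hi).2.symm.trans (mem_level.1 hi').2

/-- A rank function of a strictly acyclic graph whose chain components have common parents. -/
structure IsRank (G : PDGraph V) (r : V → ℕ) : Prop where
  lt_of_dir : ∀ i j, G.dir i j → r i < r j
  eq_iff : ∀ i j, r i = r j ↔ G.UndirReach i j
  dir_of_eq : ∀ i j k, r j = r k → G.dir i j → G.dir i k

lemma IsSAMPDAG.exists_isRank {G : PDGraph V} (hG : G.IsSAMPDAG) : ∃ r, G.IsRank r := by
  obtain ⟨r, h1, h2⟩ := hG.2.exists_rank
  exact ⟨r, h1, h2, fun i j k hjk hij => ((h2 j k).1 hjk).dir_of_dir hG hij⟩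

lemma IsRank.pa_level_subset {G : PDGraph V} {r : V → ℕ} (hr : G.IsRank r) (S T : Finset V) (k : ℕ)
    (h : (level r T k).Nonempty) : G.pa (level r S k) ⊆ G.pa (level r T k) := by
  intro i hi
  obtain ⟨j, hj, hij⟩ := mem_pa.1 hi
  obtain ⟨l, hl⟩ := h
  exact mem_pa.2 ⟨l, hl, hr.dir_of_eq i j l ((mem_level.1 hj).2.trans (mem_level.1 hl).2.symm) hij⟩

lemma IsRank.pa_level_eq {G : PDGraph V} {r : V → ℕ} (hr : G.IsRank r) {S T : Finset V} {k : ℕ}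
    (hS : (level r S k).Nonempty) (hT : (level r T k).Nonempty) :
    G.pa (level r S k) = G.pa (level r T k) :=
  (hr.pa_level_subset S T k hT).antisymm (hr.pa_level_subset T S k hS)

lemma IsRank.lt_of_mem_pa {G : PDGraph V} {r : V → ℕ} (hr : G.IsRank r) {S : Finset V} {k : ℕ}
    {i : V} (hi : i ∈ G.pa (level r S k)) : r i < k := by
  obtain ⟨j, hj, hij⟩ := mem_pa.1 hi
  exact (mem_level.1 hj).2 ▸ hr.lt_of_dir i j hij

/-- The chain rule for a density that is compatible to an SA-MPDAG: over the levels of an ancestral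
set, a density is the product of the conditional densities of the levels given their parents. -/
lemma margDensity_below_succ {G : PDGraph V} (hG : G.IsSAMPDAG) {r : V → ℕ} (hr : G.IsRank r)
    (hp : IsJointDensity μ p) (hcompat : G.IsCompatible μ p) {N : Finset V}
    (hN : G.IsAncestral N) (k : ℕ) :
    margDensity μ p (below r N (k + 1)) =ᵐ[Measure.pi μ] fun v =>
      margDensity μ p (below r N k) v * condDensity μ p (level r N k) (G.pa (level r N k)) v := by
  have hpaN : G.pa (level r N k) ⊆ below r N k := by
    intro i hi
    refine mem_below.2 ⟨?_, hr.lt_of_mem_pa hi⟩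
    exact hN.pa_subset (Finset.filter_subset _ _) hi
  rcases (level r N k).eq_empty_or_nonempty with hem | hne
  · rw [← below_union_level, hem, Finset.union_empty, pa_empty]
    exact (margDensity_mul_condDensity_empty hp (Finset.empty_subset _)).symm
  obtain ⟨D₀, E, hGE⟩ := hG.1
  obtain ⟨D, hD⟩ := hGE.2.1
  -- Each edge of `D` is directed the same way or undirected in `G`.
  have hle : ∀ i j, D.dir i j → r i ≤ r j := by
    intro i j hij
    rcases hGE.semiStep_of_dir hD hij with h | h
    · exact (hr.lt_of_dir i j h).le
    · exact ((hr.eq_iff i j).2 (Relation.ReflTransGen.single h)).le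
  have hanc : ∀ l, D.IsAncestral (below r Finset.univ l) := by
    intro l i j hij hj
    exact mem_below.2 ⟨Finset.mem_univ _, (hle i j hij).trans_lt (mem_below.1 hj).2⟩
  have hne' : (level r Finset.univ k).Nonempty :=
    hne.mono (Finset.filter_subset_filter _ (Finset.subset_univ _))
  have hpa := hr.pa_level_eq hne hne'
  -- The DAG is used on the levels of the whole node set: `N` is ancestral in `G` but need not be so
  -- in `D`. The restriction to `N` comes afterwards.
  have key := margDensity_union_of_isMarkovian hD.1 hp (hcompat D ⟨D₀, E, hGE, hD⟩)
    (hanc k) (B := level r Finset.univ k) (S := G.pa (level r N k))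
    (by rw [below_union_level]; exact hanc _) (disjoint_below_level r _ k)
    (hpaN.trans (Finset.filter_subset_filter _ (Finset.subset_univ _))) ?_
  · rw [← below_union_level]
    exact margDensity_union_mono hp hpaN (Finset.filter_subset_filter _ (Finset.subset_univ _))
      (Finset.filter_subset_filter _ (Finset.subset_univ _)) (disjoint_below_level r _ k) key
  · intro i hi
    obtain ⟨j, hj, hij⟩ := mem_pa.1 hi
    rw [hpa]
    rcases hGE.semiStep_of_dir hD hij with h | h
    · exact Finset.mem_union_right _ (mem_pa.2 ⟨j, hj, h⟩)
    · refine Finset.mem_union_left _ (mem_level.2 ⟨Finset.mem_univ _, ?_⟩)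
      exact ((hr.eq_iff i j).2 (Relation.ReflTransGen.single h)).trans (mem_level.1 hj).2

end PDGraph

end ChainRule

section Identification

variable {V : Type*} [Fintype V] [DecidableEq V] {Ω : V → Type*} [∀ i, MeasurableSpace (Ω i)]
  {μ : ∀ i, Measure (Ω i)} [∀ i, SigmaFinite (μ i)] {p : (∀ i, Ω i) → ENNReal}

namespace PDGraph

/-! ### Integrating out the levels of an ancestral set -/

/-- Conditional density of the nodes of `S` of rank `k` given their parents. -/
def levelDensity (G : PDGraph V) (r : V → ℕ) (μ : ∀ i, Measure (Ω i)) (p : (∀ i, Ω i) → ENNReal)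
    (S : Finset V) (k : ℕ) : (∀ i, Ω i) → ENNReal :=
  condDensity μ p (level r S k) (G.pa (level r S k))

lemma condDensity_empty_pa (G : PDGraph V) (hp : IsJointDensity μ p) (v : ∀ i, Ω i) :
    condDensity μ p ∅ (G.pa ∅) v = 1 := by
  rw [pa_empty, condDensity_empty_left, margDensity_empty hp, ENNReal.div_self one_ne_zero
    ENNReal.one_ne_top]

lemma levelDensity_of_eq_empty (G : PDGraph V) {r : V → ℕ} (hp : IsJointDensity μ p)
    {S : Finset V} {k : ℕ} (h : level r S k = ∅) (v : ∀ i, Ω i) :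
    G.levelDensity r μ p S k v = 1 := by
  rw [levelDensity, h, condDensity_empty_pa G hp]

lemma measurable_levelDensity (G : PDGraph V) (r : V → ℕ) (hp : Measurable p) (S : Finset V)
    (k : ℕ) : Measurable (G.levelDensity r μ p S k) :=
  measurable_condDensity hp _ _

lemma dependsOn_levelDensity (G : PDGraph V) (r : V → ℕ) {S T : Finset V} {k : ℕ}
    (h : level r S k ⊆ T) (hpa : G.pa (level r S k) ⊆ T) :
    DependsOn (G.levelDensity r μ p S k) (T : Set V) :=
  (dependsOn_condDensity _ _).mono (Finset.coe_subset.2 (Finset.union_subset h hpa))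

/-- The density of the nodes of `N` of rank less than `k`, re-weighted by the factors of `A`, times
the factors of `B` of rank at least `k`. -/
def partialDensity (G : PDGraph V) (r : V → ℕ) (μ : ∀ i, Measure (Ω i))
    (p : (∀ i, Ω i) → ENNReal) (N A B : Finset V) (K k : ℕ) (v : ∀ i, Ω i) : ENNReal :=
  margDensity μ p (below r N k) v * (∏ j ∈ Finset.range k, G.levelDensity r μ p A j v)⁻¹ *
    ∏ j ∈ Finset.Ico k K, G.levelDensity r μ p B j v

lemma measurable_partialDensity (G : PDGraph V) (r : V → ℕ) (hp : Measurable p)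
    (N A B : Finset V) (K k : ℕ) : Measurable (G.partialDensity r μ p N A B K k) :=
  ((measurable_margDensity hp _).mul (Finset.measurable_fun_prod _ fun _ _ =>
    G.measurable_levelDensity r hp A _).inv).mul (Finset.measurable_fun_prod _ fun _ _ =>
    G.measurable_levelDensity r hp B _)

section Step

variable {G : PDGraph V} {r : V → ℕ} {N A B : Finset V} {h : (∀ i, Ω i) → ENNReal}

/-- At most one of the two parts of the level is non-empty. A part in `A` cancels against its weight
where `h` is non-zero and the parents have positive density; elsewhere both sides vanish. If both
parts are empty, the remaining quotient is absorbed by the density below. -/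
lemma partialDensity_level (hr : G.IsRank r) (hp : IsJointDensity μ p) (hA : A ⊆ N) (hB : B ⊆ N)
    (hlev : ∀ k, level r A k = ∅ ∨ level r B k = ∅) (hN : G.IsAncestral N)
    (hpos : ∀ᵐ v ∂(Measure.pi μ), h v ≠ 0 → ∀ k, (level r A k).Nonempty →
      margDensity μ p (G.pa (level r A k)) v ≠ 0 → G.levelDensity r μ p A k v ≠ 0) (k : ℕ) :
    ∀ᵐ v ∂(Measure.pi μ), h v * margDensity μ p (below r N k) v * (G.levelDensity r μ p A k v)⁻¹ *
      condDensity μ p (level r A k ∪ level r B k) (G.pa (level r N k)) v =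
        h v * margDensity μ p (below r N k) v * G.levelDensity r μ p B k v := by
  have hpaN : ∀ S ⊆ N, G.pa (level r S k) ⊆ below r N k := fun S hS i hi =>
    mem_below.2 ⟨hN.pa_subset ((Finset.filter_subset _ _).trans hS) hi, hr.lt_of_mem_pa hi⟩
  have hsub : ∀ S ⊆ N, (level r S k).Nonempty → G.pa (level r N k) = G.pa (level r S k) :=
    fun S hS hne => hr.pa_level_eq (hne.mono (Finset.filter_subset_filter _ hS)) hne
  rcases (level r A k).eq_empty_or_nonempty with hAk | hAk
  · rcases (level r B k).eq_empty_or_nonempty with hBk | hBk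
    · filter_upwards [margDensity_mul_condDensity_empty hp (hpaN N le_rfl)] with v hv
      rw [levelDensity_of_eq_empty G hp hAk, levelDensity_of_eq_empty G hp hBk, hAk, hBk,
        Finset.empty_union, inv_one, mul_one, mul_assoc, hv]
    · refine Filter.Eventually.of_forall fun v => ?_
      rw [levelDensity_of_eq_empty G hp hAk, hAk, Finset.empty_union, hsub B hB hBk, inv_one,
        mul_one, levelDensity]
  · have hBk := (hlev k).resolve_left hAk.ne_empty
    filter_upwards [hpos, ae_margDensity_eq_zero hp.1 (hpaN A hA),
      ae_condDensity_lt_top hp (level r A k) (G.pa (level r A k))] with v h1 h2 h3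
    rw [levelDensity_of_eq_empty G hp hBk, hBk, Finset.union_empty, hsub A hA hAk, mul_one]
    by_cases hh : h v = 0
    · simp [hh]
    by_cases hz : margDensity μ p (G.pa (level r A k)) v = 0
    · simp [h2 hz]
    · have h4 := h1 hh k hAk hz
      rw [levelDensity] at h4 ⊢
      rw [mul_assoc, ENNReal.inv_mul_cancel h4 h3.ne, mul_one]

lemma lmarginal_level_partialDensity (hG : G.IsSAMPDAG) (hr : G.IsRank r)
    (hp : IsJointDensity μ p) (hcompat : G.IsCompatible μ p) (hN : G.IsAncestral N)
    (hA : A ⊆ N) (hB : B ⊆ N) (hpaB : G.pa B ⊆ A ∪ B)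
    (hlev : ∀ k, level r A k = ∅ ∨ level r B k = ∅)
    (hm : Measurable h) (hdep : DependsOn h (A : Set V))
    (hpos : ∀ᵐ v ∂(Measure.pi μ), h v ≠ 0 → ∀ k, (level r A k).Nonempty →
      margDensity μ p (G.pa (level r A k)) v ≠ 0 → G.levelDensity r μ p A k v ≠ 0)
    {K k : ℕ} (hk : k < K) :
    lmarginal μ (level r (N \ (A ∪ B)) k) (fun v => h v * G.partialDensity r μ p N A B K (k + 1) v)
      =ᵐ[Measure.pi μ] fun v => h v * G.partialDensity r μ p N A B K k v := by
  set C := N \ (A ∪ B) with hC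
  -- All factors except the density of level `k` of `N`. None involves the variables being
  -- integrated: the weights have their parents below `k`, and the factors of `B` have theirs in `A
  -- ∪ B`.
  let Q : (∀ i, Ω i) → ENNReal := fun v => h v * margDensity μ p (below r N k) v *
    (∏ j ∈ Finset.range k, G.levelDensity r μ p A j v)⁻¹ * (G.levelDensity r μ p A k v)⁻¹ *
    ∏ j ∈ Finset.Ico (k + 1) K, G.levelDensity r μ p B j v
  have hQm : Measurable Q :=
    (((hm.mul (measurable_margDensity hp.1 _)).mul (Finset.measurable_fun_prod _ fun _ _ =>
      G.measurable_levelDensity r hp.1 A _).inv).mul (G.measurable_levelDensity r hp.1 A _).inv).mul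
      (Finset.measurable_fun_prod _ fun _ _ => G.measurable_levelDensity r hp.1 B _)
  have hAC : A ∪ B ⊆ (level r C k)ᶜ := by
    intro i hi
    rw [Finset.mem_compl, mem_level, hC, Finset.mem_sdiff]
    exact fun h => h.1.2 hi
  have hltC : ∀ i, r i < k → i ∈ (level r C k)ᶜ := by
    intro i hi
    rw [Finset.mem_compl, mem_level]
    exact fun h => hi.ne h.2
  have hdepA : ∀ j ≤ k, DependsOn (G.levelDensity r μ p A j) (↑(level r C k)ᶜ : Set V) :=
    fun j hj => G.dependsOn_levelDensity r
      ((Finset.filter_subset _ _).trans (Finset.subset_union_left.trans hAC))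
      fun i hi => hltC i ((hr.lt_of_mem_pa hi).trans_le hj)
  have hdepB : ∀ j, DependsOn (G.levelDensity r μ p B j) (↑(level r C k)ᶜ : Set V) := by
    refine fun j => G.dependsOn_levelDensity r
      ((Finset.filter_subset _ _).trans (Finset.subset_union_right.trans hAC)) fun i hi => ?_
    obtain ⟨l, hl, hil⟩ := mem_pa.1 hi
    exact hAC (hpaB (mem_pa.2 ⟨l, (mem_level.1 hl).1, hil⟩))
  have hQdep : DependsOn Q (↑(level r C k)ᶜ : Set V) := by
    refine dependsOn_mul (dependsOn_mul (dependsOn_mul (dependsOn_mul ?_ ?_) ?_) ?_) ?_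
    · exact hdep.mono (Finset.coe_subset.2 (Finset.subset_union_left.trans hAC))
    · exact (dependsOn_margDensity _).mono
        (Finset.coe_subset.2 fun i hi => hltC i (mem_below.1 hi).2)
    · exact dependsOn_inv (dependsOn_prod fun j hj => hdepA j (Finset.mem_range.1 hj).le)
    · exact dependsOn_inv (hdepA k le_rfl)
    · exact dependsOn_prod fun j _ => hdepB j
  -- Finiteness allows the inverse of the product of weights to be split despite possible zeros.
  have hfin : ∀ᵐ v ∂(Measure.pi μ), ∀ j, G.levelDensity r μ p A j v < ⊤ :=
    ae_all_iff.2 fun j => ae_condDensity_lt_top hp _ _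
  have hmN := G.measurable_levelDensity (μ := μ) r hp.1 N k
  have h1 : (fun v => h v * G.partialDensity r μ p N A B K (k + 1) v) =ᵐ[Measure.pi μ]
      fun v => Q v * G.levelDensity r μ p N k v := by
    filter_upwards [margDensity_below_succ hG hr hp hcompat hN k, hfin] with v hv hv'
    simp only [Q, partialDensity]
    rw [hv, Finset.prod_range_succ, ENNReal.mul_inv (Or.inr (hv' k).ne)
      (Or.inl (ENNReal.prod_lt_top fun j _ => hv' j).ne), ← levelDensity]
    ring
  have h2 := lmarginal_congr_ae μ (hm.mul (G.measurable_partialDensity r hp.1 N A B K (k + 1)))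
    (g := fun v => Q v * G.levelDensity r μ p N k v) (hQm.mul hmN) h1 (level r C k)
  have h3 : lmarginal μ (level r C k) (G.levelDensity r μ p N k) =
      condDensity μ p (level r A k ∪ level r B k) (G.pa (level r N k)) := by
    refine lmarginal_condDensity hp.1 (Finset.filter_subset_filter _ Finset.sdiff_subset) ?_ ?_
    · rw [Finset.disjoint_left]
      exact fun i hi hi' => (hr.lt_of_mem_pa hi').ne (mem_level.1 hi).2
    · ext i
      have := @hA i
      have := @hB i
      simp only [hC, Finset.mem_sdiff, Finset.mem_union, mem_level]
      tauto
  rw [lmarginal_mul_left μ hQdep disjoint_compl_right hmN, h3] at h2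
  refine h2.trans ?_
  filter_upwards [partialDensity_level hr hp hA hB hlev hN hpos k] with v hv
  simp only [Q, partialDensity]
  rw [Finset.prod_eq_prod_Ico_succ_bot hk]
  calc _ = (h v * margDensity μ p (below r N k) v * (G.levelDensity r μ p A k v)⁻¹ *
        condDensity μ p (level r A k ∪ level r B k) (G.pa (level r N k)) v) *
        ((∏ j ∈ Finset.range k, G.levelDensity r μ p A j v)⁻¹ *
          ∏ j ∈ Finset.Ico (k + 1) K, G.levelDensity r μ p B j v) := by ring
    _ = _ := by rw [hv]; ring

/-- Re-weighting by the factors of `A` and integrating out the nodes outside `A` and `B` leaves the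
factors of `B`. -/
lemma lmarginal_reweighted (hG : G.IsSAMPDAG) (hr : G.IsRank r)
    (hp : IsJointDensity μ p) (hcompat : G.IsCompatible μ p) (hN : G.IsAncestral N)
    (hA : A ⊆ N) (hB : B ⊆ N) (hpaB : G.pa B ⊆ A ∪ B)
    (hlev : ∀ k, level r A k = ∅ ∨ level r B k = ∅)
    (hm : Measurable h) (hdep : DependsOn h (A : Set V))
    (hpos : ∀ᵐ v ∂(Measure.pi μ), h v ≠ 0 → ∀ k, (level r A k).Nonempty →
      margDensity μ p (G.pa (level r A k)) v ≠ 0 → G.levelDensity r μ p A k v ≠ 0)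
    {K : ℕ} (hK : ∀ i, r i < K) :
    lmarginal μ (N \ (A ∪ B)) (fun v => h v * (margDensity μ p N v *
        (∏ j ∈ Finset.range K, G.levelDensity r μ p A j v)⁻¹))
      =ᵐ[Measure.pi μ] fun v => h v * ∏ j ∈ Finset.range K, G.levelDensity r μ p B j v := by
  -- The case `k = K` is the claim; each step performs the innermost integration, over the highest
  -- remaining level.
  have key : ∀ k ≤ K, lmarginal μ (below r (N \ (A ∪ B)) k)
      (fun v => h v * G.partialDensity r μ p N A B K k v)
      =ᵐ[Measure.pi μ] fun v => h v * G.partialDensity r μ p N A B K 0 v := by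
    intro k
    induction k with
    | zero =>
      intro _
      have : below r (N \ (A ∪ B)) 0 = ∅ := by
        ext i
        simp [mem_below]
      rw [this, lmarginal_empty]
    | succ k ih =>
      intro hk
      have hmk : ∀ k, Measurable fun v => h v * G.partialDensity r μ p N A B K k v :=
        fun k => hm.mul (G.measurable_partialDensity (μ := μ) r hp.1 N A B K k)
      rw [lmarginal_eq_lmarginal_lmarginal μ (hmk _) (disjoint_below_level r _ k)
        (below_union_level r _ k)]
      exact (lmarginal_congr_ae μ ((hmk _).lmarginal μ) (hmk k)
        (lmarginal_level_partialDensity hG hr hp hcompat hN hA hB hpaB hlev hm hdep hpos hk) _).trans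
        (ih (Nat.le_of_succ_le hk))
  have hbelow : ∀ S, below r S K = S := fun S => Finset.filter_true_of_mem fun i _ => hK i
  have hzero : below r N 0 = ∅ := by
    ext i
    simp [mem_below]
  have h1 := key K le_rfl
  simp only [partialDensity, hbelow, hzero, margDensity_empty hp, Finset.Ico_self,
    Finset.prod_empty, Finset.range_zero, inv_one, mul_one, one_mul, ← Finset.range_eq_Ico] at h1
  exact h1

end Step

/-! ### Positivity -/

/-- The points at which a re-weighting factor vanishes although the parents have positive
density. -/
def degenerateSet (G : PDGraph V) (μ : ∀ i, Measure (Ω i)) (p : (∀ i, Ω i) → ENNReal)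
    (A : Finset V) : Set (∀ i, Ω i) :=
  {u | ∃ D ∈ G.chainDecomp A, margDensity μ p (G.pa D) u ≠ 0 ∧ condDensity μ p D (G.pa D) u = 0}

lemma measurableSet_degenerateSet (G : PDGraph V) (hp : Measurable p) (A : Finset V) :
    MeasurableSet (G.degenerateSet μ p A) := by
  have : G.degenerateSet μ p A = ⋃ D ∈ G.chainDecomp A,
      {u | margDensity μ p (G.pa D) u = 0}ᶜ ∩ {u | condDensity μ p D (G.pa D) u = 0} := by
    ext u
    simp only [degenerateSet, Set.mem_iUnion, exists_prop]
    rfl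
  rw [this]
  exact Finset.measurableSet_biUnion _ fun D _ =>
    ((measurable_margDensity hp _ (measurableSet_singleton 0)).compl).inter
      (measurable_condDensity hp _ _ (measurableSet_singleton 0))

/-- The values of the variables in `A` for which the degenerate set is negligible. -/
def positiveSet (G : PDGraph V) (μ : ∀ i, Measure (Ω i)) (p : (∀ i, Ω i) → ENNReal)
    (A : Finset V) : Set (∀ i, Ω i) :=
  {v | lmarginal μ Aᶜ ((G.degenerateSet μ p A).indicator 1) v = 0}

lemma measurableSet_positiveSet (G : PDGraph V) (hp : Measurable p) (A : Finset V) :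
    MeasurableSet (G.positiveSet μ p A) :=
  ((measurable_one.indicator (G.measurableSet_degenerateSet hp A)).lmarginal μ)
    (measurableSet_singleton 0)

lemma dependsOn_positiveSet (G : PDGraph V) (A : Finset V) :
    DependsOn ((G.positiveSet μ p A).indicator (1 : (∀ i, Ω i) → ENNReal)) (A : Set V) := by
  refine dependsOn_indicator_one fun x y hxy => ?_
  have := dependsOn_lmarginal μ (T := Finset.univ) Aᶜ
    (f := (G.degenerateSet μ p A).indicator (1 : (∀ i, Ω i) → ENNReal))
    (by simpa using dependsOn_univ _)
  rw [← Finset.compl_eq_univ_sdiff, compl_compl] at this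
  simp only [positiveSet, Set.mem_ofPred_eq, this hxy]

/-- Fubini turns negligibility on each positive slice into an almost sure statement on the whole
product. -/
lemma ae_notMem_degenerateSet (G : PDGraph V) (hp : Measurable p) (A : Finset V) :
    ∀ᵐ v ∂(Measure.pi μ), v ∈ G.positiveSet μ p A → v ∉ G.degenerateSet μ p A := by
  have hm1 : Measurable ((G.positiveSet μ p A).indicator (1 : (∀ i, Ω i) → ENNReal)) :=
    measurable_one.indicator (G.measurableSet_positiveSet hp A)
  have hm2 : Measurable ((G.degenerateSet μ p A).indicator (1 : (∀ i, Ω i) → ENNReal)) :=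
    measurable_one.indicator (G.measurableSet_degenerateSet hp A)
  have h0 : lmarginal μ Aᶜ (fun v => (G.positiveSet μ p A).indicator 1 v *
      (G.degenerateSet μ p A).indicator 1 v) =ᵐ[Measure.pi μ] 0 := by
    rw [lmarginal_mul_left μ (G.dependsOn_positiveSet A) disjoint_compl_left hm2]
    refine Filter.Eventually.of_forall fun v => ?_
    by_cases hv : v ∈ G.positiveSet μ p A
    · have hv' : lmarginal μ Aᶜ ((G.degenerateSet μ p A).indicator 1) v = 0 := hv
      simp [hv']
    · simp [hv]
  filter_upwards [ae_eq_zero_of_lmarginal_ae_eq_zero μ (hm1.mul hm2) h0] with v hv h1 h2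
  simp [h1, h2] at hv

lemma PositiveAt.mem_positiveSet {G : PDGraph V} (hp : IsJointDensity μ p) {A : Finset V}
    {v : ∀ i, Ω i} (h : G.PositiveAt μ p A v) : v ∈ G.positiveSet μ p A := by
  set g := (G.degenerateSet μ p A).indicator (1 : (∀ i, Ω i) → ENNReal)
  have hgm : Measurable g := measurable_one.indicator (G.measurableSet_degenerateSet hp.1 A)
  have hpm : Measurable fun w : ∀ i, Ω i => A.piecewise v w := by
    refine measurable_pi_lambda _ fun i => ?_
    by_cases hi : i ∈ A
    · simp [Finset.piecewise, hi]
    · simpa [Finset.piecewise, hi] using measurable_pi_apply i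
  have hgp : Measurable fun w => g (A.piecewise v w) := hgm.comp hpm
  -- Positivity is stated with the full product measure, though the coordinates of `w` in `A` play
  -- no role. Integrating over them only multiplies by a mass, which is non-zero because `p` has
  -- integral 1.
  have hμ : ∀ S : Finset V, Measure.pi (fun i : S => μ i) ≠ 0 := by
    intro S h0
    have h1 : lmarginal μ Finset.univ p v = 1 := by rw [lmarginal_univ, hp.2]
    rw [lmarginal_eq_lmarginal_lmarginal μ hp.1 (R := S) (S := Sᶜ) disjoint_compl_right
      (Finset.union_compl S), lmarginal, h0, lintegral_zero_measure] at h1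
    exact zero_ne_one h1
  have h1 : ∫⁻ w, g (A.piecewise v w) ∂(Measure.pi μ) = 0 := by
    rw [lintegral_eq_zero_iff hgp]
    filter_upwards [h] with w hw
    refine Set.indicator_of_notMem ?_ _
    rintro ⟨D, hD, h1, h2⟩
    exact hw D hD h1 h2
  rw [lintegral_eq_lmarginal_univ v, lmarginal_eq_lmarginal_lmarginal μ hgp (R := A)
    (S := Aᶜ) disjoint_compl_right (Finset.union_compl A)] at h1
  have h2 : lmarginal μ Aᶜ (fun w => g (A.piecewise v w)) = fun _ => lmarginal μ Aᶜ g v := by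
    ext w
    refine lintegral_congr fun z => ?_
    refine congrArg g (funext fun i => ?_)
    by_cases hi : i ∈ A <;> simp [Function.updateFinset, Finset.piecewise, hi]
  have h3 : lmarginal μ A (fun _ => lmarginal μ Aᶜ g v) v = 0 := by
    rw [← h2]
    exact h1
  rw [lmarginal, lintegral_const, mul_eq_zero, Measure.measure_univ_eq_zero] at h3
  exact h3.resolve_right (hμ A)

/-! ### Ancestors avoiding a set -/

lemma isAncestral_an (G : PDGraph V) (Y : Finset V) : G.IsAncestral (G.an Y) := by
  intro i j hij hj
  obtain ⟨y, hy, hjy⟩ := mem_an.1 hj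
  exact mem_an.2 ⟨y, hy, Relation.ReflTransGen.head hij hjy⟩

lemma subset_an (G : PDGraph V) (Y : Finset V) : Y ⊆ G.an Y :=
  fun y hy => mem_an.2 ⟨y, hy, Relation.ReflTransGen.refl⟩

lemma an_induce_subset (G : PDGraph V) (S Y : Finset V) : (G.induce S).an Y ⊆ G.an Y := by
  intro i hi
  obtain ⟨y, hy, hiy⟩ := mem_an.1 hi
  exact mem_an.2 ⟨y, hy, Relation.ReflTransGen.mono (fun _ _ h => h.1) _ _ hiy⟩

lemma disjoint_an_induce_compl (G : PDGraph V) {X Y : Finset V} (hXY : Disjoint X Y) :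
    Disjoint X ((G.induce Xᶜ).an Y) := by
  rw [Finset.disjoint_left]
  intro i hiX hi
  obtain ⟨y, hy, hiy⟩ := mem_an.1 hi
  rcases Relation.ReflTransGen.cases_head hiy with rfl | ⟨j, hij, -⟩
  · exact Finset.disjoint_left.1 hXY hiX hy
  · exact Finset.mem_compl.1 hij.2.1 hiX

lemma pa_an_induce_compl_subset (G : PDGraph V) {X Y : Finset V} (hXY : Disjoint X Y) :
    G.pa ((G.induce Xᶜ).an Y) ⊆ (X ∩ G.an Y) ∪ (G.induce Xᶜ).an Y := by
  intro i hi
  obtain ⟨j, hj, hij⟩ := mem_pa.1 hi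
  by_cases hX : i ∈ X
  · exact Finset.mem_union_left _ (Finset.mem_inter.2
      ⟨hX, G.isAncestral_an Y i j hij (G.an_induce_subset _ _ hj)⟩)
  · refine Finset.mem_union_right _ ((G.induce Xᶜ).isAncestral_an Y i j ⟨hij, ?_, ?_⟩ hj)
    · simpa using hX
    · rw [Finset.mem_compl]
      exact fun h => Finset.disjoint_left.1 (G.disjoint_an_induce_compl hXY) h hj

/-- Without a proper semi-directed path from `X` to `Y` that starts undirected, no node of `X` is
in the chain component of an ancestor of `Y` in the graph without `X`. -/
lemma not_undirReach_of_not_hasPath {G : PDGraph V} {X Y : Finset V} (hXY : Disjoint X Y)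
    (hid : ¬ G.HasProperSemiDirectedPathStartingUndirected X Y) {x b : V} (hx : x ∈ X)
    (hb : b ∈ (G.induce Xᶜ).an Y) : ¬ G.UndirReach x b := by
  have hbX := fun h => Finset.disjoint_left.1 (G.disjoint_an_induce_compl hXY) h hb
  obtain ⟨y, hy, hby⟩ := mem_an.1 hb
  have hpath : ∃ l, (∀ w ∈ b :: l, w ∉ X) ∧ (b :: l).IsChain G.SemiStep ∧
      (b :: l).getLast? = some y := by
    clear hb
    induction hby using Relation.ReflTransGen.head_induction_on with
    | refl => exact ⟨[], by simpa using hbX, by simp, rfl⟩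
    | head h _ ih =>
      obtain ⟨l, h1, h2, h3⟩ := ih (Finset.mem_compl.1 h.2.2)
      exact ⟨_ :: l, List.forall_mem_cons.2 ⟨hbX, h1⟩, List.isChain_cons_cons.2 ⟨Or.inl h.1, h2⟩,
        by simpa using h3⟩
  intro hxb
  clear hby hb
  -- Going back along the undirected path towards `x`, each node outside `X` is prepended to the
  -- path to `y`; the first node met in `X` gives a forbidden path.
  have hgen : ∀ c, G.UndirReach x c → c ∉ X → ∀ l, (∀ w ∈ c :: l, w ∉ X) →
      (c :: l).IsChain G.SemiStep → (c :: l).getLast? = some y → False := by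
    intro c hc
    induction hc with
    | refl => exact fun h => absurd hx h
    | @tail b c _ hbc ih =>
      intro hcX l h1 h2 h3
      by_cases hbX : b ∈ X
      · exact hid ⟨b, c, l, hbX, h1, List.isChain_cons_cons.2 ⟨Or.inr hbc, h2⟩, hbc, y, hy, h3⟩
      · exact ih hbX (c :: l) (List.forall_mem_cons.2 ⟨hbX, h1⟩)
          (List.isChain_cons_cons.2 ⟨Or.inr hbc, h2⟩) (by simpa using h3)
  obtain ⟨l, h1, h2, h3⟩ := hpath
  exact hgen b hxb hbX l h1 h2 h3

end PDGraph

end Identification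

end

/-! ### The identity of the two integrals -/

open PDGraph in
theorem propositionA5 {V : Type*} [Fintype V] [DecidableEq V]
    {Ω : V → Type*} [∀ i, MeasurableSpace (Ω i)]
    (μ : ∀ i, MeasureTheory.Measure (Ω i)) [∀ i, MeasureTheory.SigmaFinite (μ i)]
    (G : PDGraph V) (hG : G.IsSAMPDAG)
    (X Y : Finset V) (hXY : Disjoint X Y)
    (hid : ¬ G.HasProperSemiDirectedPathStartingUndirected X Y)
    (p : (∀ i, Ω i) → ENNReal) (hp : IsJointDensity μ p) (hcompat : G.IsCompatible μ p) :
    ∀ᵐ v ∂(MeasureTheory.Measure.pi μ), G.PositiveAt μ p (X ∩ G.an Y) v →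
      MeasureTheory.lmarginal μ ((G.induce Xᶜ).an Y \ Y)
          (fun u => ∏ B ∈ G.chainDecomp ((G.induce Xᶜ).an Y), condDensity μ p B (G.pa B) u) v =
        MeasureTheory.lmarginal μ ((X ∩ G.an Y) ∪ Y)ᶜ
          (fun u => p u / ∏ D ∈ G.chainDecomp (X ∩ G.an Y), condDensity μ p D (G.pa D) u) v := by
  obtain ⟨r, hr⟩ := hG.exists_isRank
  obtain ⟨K, hK⟩ : ∃ K, ∀ i, r i < K :=
    ⟨Finset.univ.sup r + 1, fun i => Nat.lt_succ_of_le (Finset.le_sup (Finset.mem_univ i))⟩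
  have hN := G.isAncestral_an Y
  have hBN := G.an_induce_subset Xᶜ Y
  have hYB := (G.induce Xᶜ).subset_an Y
  have hXB := G.disjoint_an_induce_compl hXY
  have hpaB := G.pa_an_induce_compl_subset hXY
  have hAX : X ∩ G.an Y ⊆ X := Finset.inter_subset_left
  have hAN : X ∩ G.an Y ⊆ G.an Y := Finset.inter_subset_right
  have hlev : ∀ k, level r (X ∩ G.an Y) k = ∅ ∨ level r ((G.induce Xᶜ).an Y) k = ∅ := by
    intro k
    by_contra! hcon
    obtain ⟨⟨a, ha⟩, b, hb⟩ := hcon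
    refine not_undirReach_of_not_hasPath hXY hid (hAX (mem_level.1 ha).1) (mem_level.1 hb).1 ?_
    exact (hr.eq_iff a b).1 ((mem_level.1 ha).2.trans (mem_level.1 hb).2.symm)
  have hprod : ∀ S u, ∏ D ∈ G.chainDecomp S, condDensity μ p D (G.pa D) u =
      ∏ k ∈ Finset.range K, G.levelDensity r μ p S k u := fun S u =>
    prod_chainDecomp hr.eq_iff hK S (fun D => condDensity μ p D (G.pa D) u)
      (condDensity_empty_pa G hp u)
  simp only [hprod]
  generalize hNdef : G.an Y = N at *
  generalize (G.induce Xᶜ).an Y = B at *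
  generalize hAdef : X ∩ N = A at *
  -- Both sides are multiplied by this indicator. It depends on `A` only, so it passes through every
  -- integral and equals 1 at the points of interest.
  let h : (∀ i, Ω i) → ENNReal := (G.positiveSet μ p A).indicator 1
  have hm : Measurable h := measurable_one.indicator (G.measurableSet_positiveSet hp.1 A)
  have hdep : DependsOn h (A : Set V) := G.dependsOn_positiveSet A
  have hpos : ∀ᵐ v ∂(Measure.pi μ), h v ≠ 0 → ∀ k, (level r A k).Nonempty →
      margDensity μ p (G.pa (level r A k)) v ≠ 0 → G.levelDensity r μ p A k v ≠ 0 := by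
    filter_upwards [G.ae_notMem_degenerateSet (μ := μ) hp.1 A] with v hv hv' k hk h1 h2
    refine hv (Set.mem_of_indicator_ne_zero hv') ⟨level r A k, ?_, h1, h2⟩
    exact (mem_chainDecomp_iff hr.eq_iff).2 ⟨hk, k, rfl⟩
  let I : (∀ i, Ω i) → ENNReal := fun v => (∏ j ∈ Finset.range K, G.levelDensity r μ p A j v)⁻¹
  let J : (∀ i, Ω i) → ENNReal := fun v => ∏ j ∈ Finset.range K, G.levelDensity r μ p B j v
  have hIm : Measurable I :=
    (Finset.measurable_fun_prod _ fun _ _ => G.measurable_levelDensity r hp.1 A _).inv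
  have hJm : Measurable J :=
    Finset.measurable_fun_prod _ fun _ _ => G.measurable_levelDensity r hp.1 B _
  have hIdep : DependsOn I (N : Set V) := by
    refine dependsOn_inv (dependsOn_prod fun j _ => G.dependsOn_levelDensity r
      ((Finset.filter_subset _ _).trans hAN) ?_)
    exact hN.pa_subset ((Finset.filter_subset _ _).trans hAN)
  have hhI : DependsOn (fun v => h v * I v) (N : Set V) :=
    dependsOn_mul (hdep.mono (Finset.coe_subset.2 hAN)) hIdep
  have hNm := measurable_margDensity (μ := μ) hp.1 N
  have hfm : Measurable fun v => h v * (margDensity μ p N v * I v) := hm.mul (hNm.mul hIm)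
  have hAB : Disjoint A B := hXB.mono_left hAX
  have hABd := Finset.disjoint_left.1 hAB
  have hR1 : lmarginal μ Nᶜ (fun v => h v * I v * p v) =
      fun v => h v * (margDensity μ p N v * I v) := by
    rw [lmarginal_mul_left μ hhI disjoint_compl_left hp.1]
    ext v
    rw [mul_assoc, mul_comm (I v)]
    rfl
  -- The complement of `A ∪ Y` is split into `B \ Y`, `N \ (A ∪ B)` and the complement of `N`, the
  -- last being integrated first.
  have hR2 : lmarginal μ (A ∪ Y)ᶜ (fun v => h v * I v * p v) = lmarginal μ (B \ Y)
      (lmarginal μ (N \ (A ∪ B)) fun v => h v * (margDensity μ p N v * I v)) := by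
    have hFm : Measurable fun v => h v * I v * p v := (hm.mul hIm).mul hp.1
    rw [← hR1, ← lmarginal_eq_lmarginal_lmarginal μ hFm (T := (N \ (A ∪ B)) ∪ Nᶜ) _ rfl]
    · refine lmarginal_eq_lmarginal_lmarginal μ hFm ?_ ?_
      · rw [Finset.disjoint_left]
        intro i hi
        have := @hBN i
        simp only [Finset.mem_sdiff, Finset.mem_union, Finset.mem_compl] at hi ⊢
        tauto
      · ext i
        have := @hBN i
        have := @hAN i
        have := @hYB i
        have := @hABd i
        simp only [Finset.mem_sdiff, Finset.mem_union, Finset.mem_compl]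
        tauto
    · exact disjoint_compl_right.mono_left Finset.sdiff_subset
  have key := lmarginal_congr_ae μ (hfm.lmarginal μ) (g := fun v => h v * J v) (hm.mul hJm)
    (lmarginal_reweighted hG hr hp hcompat hN hAN hBN hpaB hlev hm hdep hpos hK) (B \ Y)
  rw [← hR2, lmarginal_mul_left μ hdep (hAB.symm.mono_left Finset.sdiff_subset) hJm] at key
  have hL : lmarginal μ (A ∪ Y)ᶜ (fun v => h v * I v * p v) =
      fun v => h v * lmarginal μ (A ∪ Y)ᶜ (fun u => p u / ∏ k ∈ Finset.range K,
        G.levelDensity r μ p A k u) v := by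
    rw [← lmarginal_mul_left μ hdep
      (disjoint_compl_left.mono_left (Finset.compl_subset_compl.2 Finset.subset_union_left))]
    · congr 1
      ext v
      rw [div_eq_mul_inv, mul_assoc, mul_comm (I v)]
    · exact hp.1.mul hIm
  rw [hL] at key
  filter_upwards [key] with v hv hposv
  have hone : h v = 1 := by
    simp [h, PositiveAt.mem_positiveSet hp hposv]
  rw [hone, one_mul, one_mul] at hv
  exact hv.symm
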